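/- Let $\mathbf F_q$ be a finite field with $q$ elements, $A=\mathbf F_q[T]$, $K=\mathbf F_q(T)$, and let $L$ be a finite extension of $\mathbf F_q$ of degree $n$, made into an $A$-field by an $\mathbf F_q$-algebra homomorphism $\gamma:A\to L$ with kernel $P$ (the characteristic). Let $L\{\tau\}$ be the Ore polynomial ring, with $\tau\lambda=\lambda^q\tau$ for $\lambda\in L$, and let $\Phi:A\to L\{\tau\}$, $a\mapsto\Phi_a$, be a Drinfeld $A$-module of rank $2$, i.e. an $\mathbf F_q$-algebra homomorphism with $\Phi_T=\gamma(T)+a_2\tau+a_3\tau^2$, $a_2,a_3\in L$, $a_3\neq0$. Let $\tau$ act on $\overline L$ by $x\mapsto x^q$; write $L^\Phi$ for the additive group of $L$ with the $A$-module structure $a\cdot x=\Phi_a(x)$, $\operatorname{End}_L\Phi$ for the ring of all $u\in L\{\tau\}$ with $u\Phi_a=\Phi_au$ for all $a\in A$ (an $A$-algebra through $\Phi$), and $F=\tau^n\in\operatorname{End}_L\Phi$ for the Frobenius of $L$. Let $P_\Phi(X)=X^2-cX+N$, with $c,N\in A$, be the characteristic polynomial of $F$, that is, the power of degree $2$ of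 the minimal polynomial of $F$ over $A$, and let $\Delta=c^2-4N$ be its discriminant. An $A$-order of $K(F)\subset K\otimes_A\operatorname{End}_L\Phi$ is an $A$-subalgebra that is finitely generated as an $A$-module and spans $K(F)$ over $K$; its discriminant is the ideal of $A$ generated by $\det(\operatorname{Tr}(b_ib_j))$ for an $A$-basis $(b_i)$ of it. Assume that $\Phi$ is ordinary, i.e. that $\{x\in\overline L:\Phi_a(x)=0\text{ for all }a\in P\}\neq0$. Let $\rho\neq P$ be an ideal of $A$ with $\rho^2\mid (P_\Phi(1))$ and $\rho\mid (c-2)$. Then there is exactly one $A$-order $O$ of $K(F)$ whose discriminant $\mathfrak d$ satisfies $\mathfrak d\,\rho^2=(\Delta)$; it is denoted $O(\Delta/\rho^2)$. Moreover, $\Phi(\rho)=(A/\rho)^2$ is contained in $L^\Phi$ (that is, there is an injective $A$-linear map $(A/\rho)^2\to L^\Phi$) if and only if $O(\Delta/\rho^2)\subset\operatorname{End}_L\Phi$. -/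

import Mathlib

open Polynomial
open scoped TensorProduct

noncomputable section

/-- A copy of the field `L`, remembering the base field `Fq`; on it `Multiplicative ℕ` acts through
the `q`-power Frobenius, which is the twist used for the Ore polynomials below. -/
def FrobField (_Fq L : Type*) : Type _ := L

namespace FrobField

variable (Fq L : Type*) [Field Fq] [Fintype Fq] [Field L] [Algebra Fq L]

instance : Field (FrobField Fq L) := inferInstanceAs (Field L)

instance : Algebra Fq (FrobField Fq L) := inferInstanceAs (Algebra Fq L)

/-- The identity map `FrobField Fq L → L`. -/
def equiv : FrobField Fq L ≃ₐ[Fq] L := AlgEquiv.refl (R := Fq) (A₁ := L)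

/-- The generator of `Multiplicative ℕ` acts by `x ↦ x ^ q`. -/
instance : MulSemiringAction (Multiplicative ℕ) (FrobField Fq L) where
  smul k x := x ^ Fintype.card Fq ^ k.toAdd
  one_smul x := by
    change x ^ Fintype.card Fq ^ 0 = x
    simp
  mul_smul j k x := by
    change x ^ Fintype.card Fq ^ (j.toAdd + k.toAdd) =
      (x ^ Fintype.card Fq ^ k.toAdd) ^ Fintype.card Fq ^ j.toAdd
    rw [← pow_mul, ← pow_add, add_comm]
  smul_zero k := by
    change (0 : FrobField Fq L) ^ Fintype.card Fq ^ k.toAdd = 0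
    exact zero_pow (pow_ne_zero _ Fintype.card_ne_zero)
  smul_add k x y := by
    change (x + y) ^ Fintype.card Fq ^ k.toAdd =
      x ^ Fintype.card Fq ^ k.toAdd + y ^ Fintype.card Fq ^ k.toAdd
    have h := congrArg (fun f : FrobField Fq L → FrobField Fq L => f (x + y))
      (pow_iterate (M := FrobField Fq L) (Fintype.card Fq) k.toAdd)
    have hx := congrArg (fun f : FrobField Fq L → FrobField Fq L => f x)
      (pow_iterate (M := FrobField Fq L) (Fintype.card Fq) k.toAdd)
    have hy := congrArg (fun f : FrobField Fq L → FrobField Fq L => f y)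
      (pow_iterate (M := FrobField Fq L) (Fintype.card Fq) k.toAdd)
    beta_reduce at h hx hy
    rw [← h, ← hx, ← hy, ← FiniteField.coe_frobeniusAlgHom]
    exact iterate_map_add (FiniteField.frobeniusAlgHom Fq (FrobField Fq L)) _ x y
  smul_one k := by
    change (1 : FrobField Fq L) ^ Fintype.card Fq ^ k.toAdd = 1
    exact one_pow _
  smul_mul k x y := by
    change (x * y) ^ Fintype.card Fq ^ k.toAdd =
      x ^ Fintype.card Fq ^ k.toAdd * y ^ Fintype.card Fq ^ k.toAdd
    exact mul_pow _ _ _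

lemma smul_def (k : Multiplicative ℕ) (x : FrobField Fq L) :
    k • x = x ^ Fintype.card Fq ^ k.toAdd := rfl

instance : SMulCommClass (Multiplicative ℕ) Fq (FrobField Fq L) where
  smul_comm k c x := by
    rw [smul_def, smul_def, _root_.smul_pow, FiniteField.pow_card_pow]

end FrobField

/-- The Ore polynomial ring `L{τ}`, with `τ λ = λ ^ q τ` for `λ ∈ L`. -/
abbrev OrePoly (Fq L : Type*) [Field Fq] [Fintype Fq] [Field L] [Algebra Fq L] : Type _ :=
  SkewPolynomial (FrobField Fq L)

namespace OrePoly

variable (Fq L : Type*) [Field Fq] [Fintype Fq] [Field L] [Algebra Fq L]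

/-- The variable `τ`. -/
def tau : OrePoly Fq L := SkewPolynomial.X

variable {L} in
/-- The constant Ore polynomial `a`. -/
def const (a : L) : OrePoly Fq L := SkewPolynomial.C ((FrobField.equiv Fq L).symm a)

/-- For a commutative `L`-algebra `M`, the action of `L{τ}` on `M`:
`∑ aᵢ τ ^ i` acts as `x ↦ ∑ aᵢ x ^ (q ^ i)`. -/
def eval (M : Type*) [CommRing M] [Algebra Fq M] [Algebra L M] [IsScalarTower Fq L M] :
    OrePoly Fq L →ₐ[Fq] Module.End Fq M :=
  SkewMonoidAlgebra.liftNCAlgHom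
    ((Algebra.lsmul Fq Fq M : L →ₐ[Fq] Module.End Fq M).comp
      (FrobField.equiv Fq L : FrobField Fq L →ₐ[Fq] L))
    (powersHom _ (FiniteField.frobeniusAlgHom Fq M).toLinearMap)
    (by
      intro x y
      have key : ∀ (k : ℕ) (m : M),
          ((FiniteField.frobeniusAlgHom Fq M).toLinearMap ^ k) m = m ^ Fintype.card Fq ^ k := by
        intro k m
        rw [Module.End.pow_apply]
        exact congrFun (pow_iterate (M := M) (Fintype.card Fq) k) m
      ext m
      simp only [powersHom_apply, Module.End.mul_apply, key]
      change (FrobField.equiv Fq L (x ^ Fintype.card Fq ^ y.toAdd)) • m ^ Fintype.card Fq ^ y.toAdd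
        = (FrobField.equiv Fq L x • m) ^ Fintype.card Fq ^ y.toAdd
      rw [map_pow, _root_.smul_pow])

end OrePoly

/-- A Drinfeld `Fq[T]`-module of rank 2 over the `Fq[T]`-field `γ : Fq[T] → L`: a homomorphism
`Φ : Fq[T] → L{τ}` with `Φ(T) = γ(T) + a₂ τ + a₃ τ ^ 2` and `a₃ ≠ 0`. -/
structure DrinfeldModuleRankTwo (Fq L : Type*) [Field Fq] [Fintype Fq] [Field L] [Algebra Fq L]
    (γ : Fq[X] →ₐ[Fq] L) where
  toAlgHom : Fq[X] →ₐ[Fq] OrePoly Fq L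
  rank_two : ∃ a₂ a₃ : L, a₃ ≠ 0 ∧
    toAlgHom X = OrePoly.const Fq (γ X) + OrePoly.const Fq a₂ * OrePoly.tau Fq L +
      OrePoly.const Fq a₃ * OrePoly.tau Fq L ^ 2

namespace DrinfeldModuleRankTwo

variable {Fq L : Type*} [Field Fq] [Fintype Fq] [Field L] [Algebra Fq L] {γ : Fq[X] →ₐ[Fq] L}
variable (Φ : DrinfeldModuleRankTwo Fq L γ)

/-- The action `x ↦ Φ_a(x)` of `a ∈ Fq[T]` on an `L`-algebra `M`. -/
def act (M : Type*) [CommRing M] [Algebra Fq M] [Algebra L M] [IsScalarTower Fq L M] :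
    Fq[X] →ₐ[Fq] Module.End Fq M :=
  (OrePoly.eval Fq L M).comp Φ.toAlgHom

/-- `L^Φ`: the additive group of `L` with the `Fq[T]`-module structure induced by `Φ`. -/
def Points (_Φ : DrinfeldModuleRankTwo Fq L γ) : Type _ := L

instance : AddCommGroup Φ.Points := inferInstanceAs (AddCommGroup L)

instance : Module Fq[X] Φ.Points := Module.compHom L (Φ.act L).toRingHom

/-- `Φ` is ordinary: the module of `P`-division points of `Φ` in an algebraic closure of `L`, where
`P = ker γ` is the characteristic, is nontrivial. -/
def IsOrdinary : Prop :=
  ∃ x : AlgebraicClosure L, x ≠ 0 ∧ ∀ a ∈ RingHom.ker γ, Φ.act (AlgebraicClosure L) a x = 0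

/-- `End_L Φ`: the Ore polynomials commuting with all `Φ_a`. -/
def End : Type _ := Subalgebra.centralizer Fq (Set.range Φ.toAlgHom)

instance : Ring Φ.End :=
  inferInstanceAs (Ring (Subalgebra.centralizer Fq (Set.range Φ.toAlgHom)))

/-- The structure map `a ↦ Φ_a` from `Fq[T]` to `End_L Φ`. -/
def toEnd : Fq[X] →+* Φ.End :=
  Φ.toAlgHom.toRingHom.codRestrict
    (Subalgebra.centralizer Fq (Set.range Φ.toAlgHom)).toSubring (by
      rintro a _ ⟨b, rfl⟩
      exact ((Commute.all b a).map Φ.toAlgHom).eq)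

instance : Algebra Fq[X] Φ.End :=
  RingHom.toAlgebra' Φ.toEnd fun a x => Subtype.ext (x.2 _ ⟨a, rfl⟩)

/-- The Frobenius `F = τ ^ n` of `L`, `n = [L : Fq]`, as an endomorphism of `Φ`. -/
def frob [Finite L] : Φ.End :=
  ⟨OrePoly.tau Fq L ^ Module.finrank Fq L, by
    rintro p -
    have := Fintype.ofFinite L
    have h : ∀ x : FrobField Fq L,
        (SkewPolynomial.φ (R := FrobField Fq L))^[Module.finrank Fq L] x = x := by
      intro x
      rw [SkewPolynomial.φ_iterate_apply, FrobField.smul_def, toAdd_ofAdd,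
        ← Module.card_eq_pow_finrank (K := Fq) (V := L)]
      exact FiniteField.pow_card (K := L) x
    have h2 := SkewPolynomial.X_pow_mul (p := p) (n := Module.finrank Fq L)
    simp only [h, SkewPolynomial.sum_monomial] at h2
    exact h2.symm⟩

/-- The characteristic polynomial `P_Φ(X) = X ^ 2 - c X + N` of the Frobenius `F`, over `Fq[T]`:
the power of degree 2 of the minimal polynomial of `F` over `Fq[T]`. (For an ordinary `Φ` it is the
characteristic polynomial of multiplication by `F` on the quadratic field `K(F)`, and in general it
is that of `F` on the Tate modules of `Φ`, which have rank 2.) -/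
def charpoly [Finite L] : Fq[X][X] :=
  minpoly Fq[X] Φ.frob ^ (2 / (minpoly Fq[X] Φ.frob).natDegree)

/-- The trace `c` of the Frobenius. -/
def trace [Finite L] : Fq[X] := -Φ.charpoly.coeff 1

/-- The discriminant `Δ = c ^ 2 - 4 N` of the characteristic polynomial `X ^ 2 - c X + N`. -/
def discriminant [Finite L] : Fq[X] := Φ.trace ^ 2 - 4 * Φ.charpoly.coeff 0

/-- `K ⊗ End_L Φ`, with `K = Fq(T)`. -/
def EndK : Type _ := FractionRing Fq[X] ⊗[Fq[X]] Φ.End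

instance : Ring Φ.EndK := inferInstanceAs (Ring (FractionRing Fq[X] ⊗[Fq[X]] Φ.End))

instance : Algebra (FractionRing Fq[X]) Φ.EndK :=
  inferInstanceAs (Algebra (FractionRing Fq[X]) (FractionRing Fq[X] ⊗[Fq[X]] Φ.End))

instance : Algebra Fq[X] Φ.EndK :=
  inferInstanceAs (Algebra Fq[X] (FractionRing Fq[X] ⊗[Fq[X]] Φ.End))

instance : IsScalarTower Fq[X] (FractionRing Fq[X]) Φ.EndK :=
  inferInstanceAs (IsScalarTower Fq[X] (FractionRing Fq[X])
    (FractionRing Fq[X] ⊗[Fq[X]] Φ.End))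

/-- The canonical map `x ↦ 1 ⊗ x` from `End_L Φ` to `K ⊗ End_L Φ`. -/
def toEndK : Φ.End →ₐ[Fq[X]] Φ.EndK :=
  (Algebra.TensorProduct.includeRight : Φ.End →ₐ[Fq[X]] FractionRing Fq[X] ⊗[Fq[X]] Φ.End)

/-- `K(F)`, the `K`-subalgebra of `K ⊗ End_L Φ` generated by the Frobenius. -/
def frobField [Finite L] : Subalgebra (FractionRing Fq[X]) Φ.EndK :=
  Algebra.adjoin (FractionRing Fq[X]) {Φ.toEndK Φ.frob}

/-- `O` is an `Fq[T]`-order of `K(F)`: a subring of `K(F)` containing `Fq[T]`, finitely generated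
as an `Fq[T]`-module and spanning `K(F)` over `K`. -/
def IsOrder [Finite L] (O : Subalgebra Fq[X] Φ.EndK) : Prop :=
  (Subalgebra.toSubmodule O).FG ∧
    Submodule.span (FractionRing Fq[X]) (O : Set Φ.EndK) = Subalgebra.toSubmodule Φ.frobField

/-- The discriminant of an order of rank 2, as an ideal: it is generated by
`det (Tr (bᵢ bⱼ))` for any basis `b` over `Fq[T]`. -/
def orderDisc (O : Subalgebra Fq[X] Φ.EndK) : Ideal Fq[X] :=
  Ideal.span {d | ∃ b : Module.Basis (Fin 2) Fq[X] O,
    d = (Matrix.of fun i j => LinearMap.trace Fq[X] O (LinearMap.mulLeft Fq[X] (b i * b j))).det}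

/-- The image of `End_L Φ` in `K ⊗ End_L Φ`. -/
def endImage : Subalgebra Fq[X] Φ.EndK := Φ.toEndK.range

/-- The module `Φ(ρ) = (A/ρ)²` is contained in (embeds as an `Fq[T]`-module into) `L^Φ`. -/
def TorsionContained (ρ : Ideal Fq[X]) : Prop :=
  ∃ f : ((Fq[X] ⧸ ρ) × (Fq[X] ⧸ ρ)) →ₗ[Fq[X]] Φ.Points, Function.Injective f

end DrinfeldModuleRankTwo

end

/-! ### Ore polynomials as linearized polynomials under composition -/

namespace OrePoly

variable {Fq L : Type*} [Field Fq] [Fintype Fq] [Field L] [Algebra Fq L]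

/-! Write `ρ = (r)`. Both sides of the equivalence say that `r` divides `F - 1` in `End_L Φ`.

If it does, each `Φ_d` with `d ∣ r` is a right factor of `τ ^ n - 1`, whose linearized polynomial is
`X ^ #L - X`. So `Φ_d` has all its `q ^ (2 deg d)` roots in `L`, and these counts for all `d ∣ r`
force a copy of `(A/r)²`. Conversely, a copy of `(A/r)²` in `L^Φ` gives as many zeros of `Φ_r` as
its degree; the remainder of `τ ^ n - 1` on right division by `Φ_r` vanishes at all of them, hence
is zero. This is `torsionContained_span_iff`.

For the order, put `g = (F - 1) / r`. The divisibility hypotheses give `g² = t g - m` with `t = (c -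
2) / r` and `m = P_Φ(1) / r²` in `A`, so `A + A g` has discriminant `t² - 4m = Δ / r²`. By
`eq_order_of_span_basisDisc_eq` no other order in `K(F)` has it, and it lies in `End_L Φ` exactly
when `g` does (`order_le_endImage_iff`).

It remains that `K(F)` is quadratic and `Δ ≠ 0`. `exists_frobenius_quadratic` gives a quadratic
equation, by Cayley-Hamilton for a 2 by 2 matrix of `F` over `L[T]`. Ordinariness shows that no
positive power of `τ` lies in `K` (`IsOrdinary.eq_zero_of_tau_pow_mul_eq`), which bounds the degree
below and settles `Δ ≠ 0` in characteristic 2. -/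

lemma eval_monomial (M : Type*) [CommRing M] [Algebra Fq M] [Algebra L M] [IsScalarTower Fq L M]
    (k : ℕ) (a : FrobField Fq L) (m : M) :
    eval Fq L M (SkewPolynomial.monomial k a) m =
      FrobField.equiv Fq L a • m ^ Fintype.card Fq ^ k := by
  have key : ((FiniteField.frobeniusAlgHom Fq M).toLinearMap ^ k) m =
      m ^ Fintype.card Fq ^ k := by
    rw [Module.End.pow_apply]
    exact congrFun (pow_iterate (M := M) (Fintype.card Fq) k) m
  rw [← key]
  change (SkewMonoidAlgebra.liftNC _ _ (SkewMonoidAlgebra.single _ _) : Module.End Fq M) m = _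
  rw [SkewMonoidAlgebra.liftNC_single]
  rfl

lemma induction_add {motive : OrePoly Fq L → Prop} (u : OrePoly Fq L) (h0 : motive 0)
    (hadd : ∀ u v, motive u → motive v → motive (u + v))
    (hm : ∀ k a, motive (SkewPolynomial.monomial k a)) : motive u :=
  SkewPolynomial.induction u h0 fun k a _ _ _ h => hadd _ _ (hm k a) h

/-- The `q`-linearized polynomial `∑ aᵢ X ^ (q ^ i)` attached to `∑ aᵢ τ ^ i`. -/
noncomputable def lin : OrePoly Fq L →ₗ[Fq] L[X] :=
  (LinearMap.applyₗ (X : L[X])).comp (eval Fq L L[X]).toLinearMap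

lemma lin_apply (u : OrePoly Fq L) : lin u = eval Fq L L[X] u X := rfl

lemma lin_monomial (k : ℕ) (a : FrobField Fq L) :
    lin (SkewPolynomial.monomial k a : OrePoly Fq L) =
      C (FrobField.equiv Fq L a) * X ^ Fintype.card Fq ^ k := by
  rw [lin_apply, eval_monomial, smul_eq_C_mul]

lemma eval_eq_aeval_lin (M : Type*) [CommRing M] [Algebra Fq M] [Algebra L M]
    [IsScalarTower Fq L M] (u : OrePoly Fq L) (m : M) :
    eval Fq L M u m = aeval m (lin u) := by
  induction u using induction_add with
  | h0 => simp
  | hadd u v hu hv => simp [hu, hv]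
  | hm k a => rw [eval_monomial, lin_monomial]; simp [Algebra.smul_def]

lemma lin_mul (u v : OrePoly Fq L) : lin (u * v) = (lin u).comp (lin v) := by
  rw [lin_apply, map_mul, Module.End.mul_apply, eval_eq_aeval_lin, ← lin_apply]
  rfl

lemma lin_one : lin (1 : OrePoly Fq L) = X := by
  rw [lin_apply, map_one, Module.End.one_apply]

lemma lin_tau : lin (tau Fq L) = X ^ Fintype.card Fq := by
  have := lin_monomial (Fq := Fq) (L := L) 1 1
  rw [map_one (FrobField.equiv Fq L), C_1, one_mul, pow_one] at this
  exact this

lemma lin_tau_pow (k : ℕ) : lin (tau Fq L ^ k) = X ^ Fintype.card Fq ^ k := by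
  have := lin_monomial (Fq := Fq) (L := L) k 1
  rw [SkewPolynomial.monomial_one_right_eq_X_pow, map_one (FrobField.equiv Fq L), C_1, one_mul] at this
  exact this

lemma lin_const (a : L) : lin (const Fq a) = C a * X := by
  have := lin_monomial (Fq := Fq) (L := L) 0 ((FrobField.equiv Fq L).symm a)
  rw [pow_zero, pow_one, AlgEquiv.apply_symm_apply] at this
  exact this

lemma coeff_lin (u : OrePoly Fq L) (k : ℕ) :
    (lin u).coeff (Fintype.card Fq ^ k) = FrobField.equiv Fq L (SkewPolynomial.coeff u k) := by
  have hq := Fintype.one_lt_card (α := Fq)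
  induction u using induction_add with
  | h0 => simp
  | hadd u v hu hv =>
    rw [map_add, coeff_add, hu, hv, ← map_add, SkewPolynomial.coeff_add]
  | hm j a =>
    rw [lin_monomial, coeff_C_mul_X_pow, SkewPolynomial.coeff_monomial]
    by_cases h : j = k
    · subst h; simp
    · rw [if_neg h, if_neg, map_zero]
      exact fun h' => h (Nat.pow_right_injective hq h').symm

lemma exists_eq_pow_of_coeff_lin_ne_zero (u : OrePoly Fq L) {j : ℕ} (h : (lin u).coeff j ≠ 0) :
    ∃ k, j = Fintype.card Fq ^ k := by
  induction u using induction_add with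
  | h0 => simp at h
  | hadd u v hu hv =>
    rw [map_add, coeff_add] at h
    by_cases h' : (lin u).coeff j = 0
    · rw [h', zero_add] at h
      exact hv h
    · exact hu h'
  | hm k a =>
    rw [lin_monomial, coeff_C_mul_X_pow] at h
    exact ⟨k, by_contra fun h' => h (if_neg h')⟩

lemma lin_injective : Function.Injective (lin : OrePoly Fq L →ₗ[Fq] L[X]) := by
  refine (injective_iff_map_eq_zero _).2 fun u hu => ?_
  rw [← SkewPolynomial.support_eq_empty, Finset.eq_empty_iff_forall_notMem]
  intro k
  rw [SkewPolynomial.notMem_support_iff]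
  apply (FrobField.equiv Fq L).injective
  rw [← coeff_lin, hu, coeff_zero, map_zero]

lemma lin_eq_zero {u : OrePoly Fq L} : lin u = 0 ↔ u = 0 :=
  map_eq_zero_iff _ lin_injective

lemma coeff_lin_zero (u : OrePoly Fq L) : (lin u).coeff 0 = 0 := by
  by_contra h
  obtain ⟨k, hk⟩ := exists_eq_pow_of_coeff_lin_ne_zero u h
  exact pow_ne_zero k Fintype.card_ne_zero hk.symm

/-- The linear coefficient is the derivative at `0`, and linearized polynomials fix `0`, so this is
the chain rule. -/
lemma coeff_lin_mul_one (u v : OrePoly Fq L) :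
    (lin (u * v)).coeff 1 = (lin u).coeff 1 * (lin v).coeff 1 := by
  have h (w : L[X]) : w.coeff 1 = (derivative w).eval 0 := by
    rw [← coeff_zero_eq_eval_zero, coeff_derivative]; simp
  rw [h, h, h, lin_mul, derivative_comp, eval_mul, eval_comp, ← coeff_zero_eq_eval_zero (lin v),
    coeff_lin_zero, mul_comm]

lemma natDegree_lin_mul (u v : OrePoly Fq L) :
    (lin (u * v)).natDegree = (lin u).natDegree * (lin v).natDegree := by
  rw [lin_mul, natDegree_comp]

instance : NoZeroDivisors (OrePoly Fq L) where
  eq_zero_or_eq_zero_of_mul_eq_zero {u v} h := by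
    rw [← lin_eq_zero, lin_mul, comp_eq_zero_iff] at h
    rcases h with h | ⟨-, h⟩
    · exact Or.inl (lin_eq_zero.1 h)
    · rw [coeff_lin_zero, C_0] at h
      exact Or.inr (lin_eq_zero.1 h)

instance : Nontrivial (OrePoly Fq L) :=
  ⟨⟨0, 1, fun h => X_ne_zero (R := L) (by rw [← lin_one (Fq := Fq), ← h, map_zero])⟩⟩

instance : IsDomain (OrePoly Fq L) := NoZeroDivisors.to_isDomain _

lemma exists_natDegree_lin_eq_pow {u : OrePoly Fq L} (hu : u ≠ 0) :
    ∃ k, (lin u).natDegree = Fintype.card Fq ^ k :=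
  exists_eq_pow_of_coeff_lin_ne_zero u (leadingCoeff_ne_zero.2 (mt lin_eq_zero.1 hu))

/-- Right division by a nonzero Ore polynomial. -/
lemma exists_eq_mul_add {d : OrePoly Fq L} (hd : d ≠ 0) (v : OrePoly Fq L) :
    ∃ u s, v = u * d + s ∧ (lin s).degree < (lin d).degree := by
  induction hN : (lin v).natDegree using Nat.strong_induction_on generalizing v with
  | _ N ih =>
  subst hN
  by_cases hlt : (lin v).degree < (lin d).degree
  · exact ⟨0, v, by simp, hlt⟩
  have hv : v ≠ 0 := by
    rintro rfl
    rw [map_zero, degree_zero, not_lt, le_bot_iff, degree_eq_bot, lin_eq_zero] at hlt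
    exact hd hlt
  have hd0 : lin d ≠ 0 := mt lin_eq_zero.1 hd
  have hv0 : lin v ≠ 0 := mt lin_eq_zero.1 hv
  obtain ⟨i, hi⟩ := exists_natDegree_lin_eq_pow hd
  obtain ⟨j, hj⟩ := exists_natDegree_lin_eq_pow hv
  have hij : i ≤ j := by
    rw [not_lt, degree_eq_natDegree hd0, degree_eq_natDegree hv0, hi, hj, Nat.cast_le] at hlt
    exact (Nat.pow_le_pow_iff_right Fintype.one_lt_card).1 hlt
  obtain ⟨k, rfl⟩ := Nat.exists_eq_add_of_le hij
  -- Chosen so that `a τ ^ k d` has the leading term of `v`; left multiplication by `τ ^ k` raises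
  -- the leading coefficient of `d` to the power `q ^ k`.
  set a : L := (lin v).leadingCoeff / (lin d).leadingCoeff ^ Fintype.card Fq ^ k with ha
  have hdl : (lin d).leadingCoeff ^ Fintype.card Fq ^ k ≠ 0 :=
    pow_ne_zero _ (leadingCoeff_ne_zero.2 hd0)
  have ha0 : a ≠ 0 := div_ne_zero (leadingCoeff_ne_zero.2 hv0) hdl
  set w : OrePoly Fq L := SkewPolynomial.monomial k ((FrobField.equiv Fq L).symm a)
  have hw : lin (w * d) = C a * lin d ^ Fintype.card Fq ^ k := by
    rw [lin_mul, lin_monomial, AlgEquiv.apply_symm_apply, mul_comp, C_comp, X_pow_comp]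
  have hdeg : (lin (v - w * d)).degree < (lin v).degree := by
    rw [map_sub, hw]
    refine degree_sub_lt_left ?_ hv0 ?_
    · rw [degree_C_mul ha0, degree_pow, degree_eq_natDegree hd0, degree_eq_natDegree hv0, hi, hj,
        pow_add, nsmul_eq_mul, mul_comm, Nat.cast_mul]
    · rw [leadingCoeff_mul, leadingCoeff_C, leadingCoeff_pow, ha, div_mul_cancel₀ _ hdl]
  by_cases h0 : v - w * d = 0
  · exact ⟨w, 0, by rw [add_zero]; exact sub_eq_zero.1 h0, by
      rw [map_zero, degree_zero]; exact bot_lt_iff_ne_bot.2 (mt degree_eq_bot.1 hd0)⟩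
  obtain ⟨u, s, hus, hs⟩ := ih _ (natDegree_lt_natDegree (mt lin_eq_zero.1 h0) hdeg) _ rfl
  exact ⟨u + w, s, by rw [add_mul, add_right_comm, ← hus, sub_add_cancel], hs⟩

end OrePoly

/-! ### Linear coefficient and degree of `Φ_a` -/

namespace DrinfeldModuleRankTwo

open OrePoly

variable {Fq L : Type*} [Field Fq] [Fintype Fq] [Field L] [Algebra Fq L] {γ : Fq[X] →ₐ[Fq] L}
variable (Φ : DrinfeldModuleRankTwo Fq L γ)

lemma act_apply (M : Type*) [CommRing M] [Algebra Fq M] [Algebra L M] [IsScalarTower Fq L M]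
    (a : Fq[X]) (m : M) : Φ.act M a m = aeval m (lin (Φ.toAlgHom a)) :=
  eval_eq_aeval_lin M _ m

/-- The identity map `L^Φ → L`. -/
noncomputable def pointsEquiv : Φ.Points ≃+ L := AddEquiv.refl L

lemma pointsEquiv_smul (a : Fq[X]) (x : Φ.Points) :
    Φ.pointsEquiv (a • x) = (lin (Φ.toAlgHom a)).eval (Φ.pointsEquiv x) :=
  (Φ.act_apply L a (Φ.pointsEquiv x)).trans (by rw [coe_aeval_eq_eval])

lemma lin_toAlgHom_C (c : Fq) : lin (Φ.toAlgHom (C c)) = C (algebraMap Fq L c) * X := by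
  rw [show (C c : Fq[X]) = algebraMap Fq Fq[X] c from rfl, AlgHom.commutes,
    Algebra.algebraMap_eq_smul_one, map_smul, lin_one, Algebra.smul_def]
  rfl

lemma lin_toAlgHom_X : ∃ a₂ a₃ : L, a₃ ≠ 0 ∧ lin (Φ.toAlgHom X) =
    C (γ X) * X + C a₂ * X ^ Fintype.card Fq + C a₃ * X ^ Fintype.card Fq ^ 2 := by
  obtain ⟨a₂, a₃, h, hX⟩ := Φ.rank_two
  refine ⟨a₂, a₃, h, ?_⟩
  rw [hX, map_add, map_add, lin_mul, lin_mul, lin_const, lin_const, lin_const, lin_tau,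
    lin_tau_pow, mul_comp, mul_comp, C_comp, C_comp, X_comp, X_comp]

lemma coeff_one_lin_toAlgHom (a : Fq[X]) : (lin (Φ.toAlgHom a)).coeff 1 = γ a := by
  have hq := Fintype.one_lt_card (α := Fq)
  induction a using Polynomial.induction_on with
  | C c =>
    rw [lin_toAlgHom_C, coeff_C_mul, coeff_X_one, mul_one,
      show (C c : Fq[X]) = algebraMap Fq Fq[X] c from rfl, AlgHom.commutes]
  | add a b ha hb => rw [map_add, map_add, coeff_add, ha, hb, map_add]
  | monomial n c h =>
    rw [pow_succ, ← mul_assoc, map_mul, coeff_lin_mul_one, h, map_mul γ _ X]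
    congr 1
    obtain ⟨a₂, a₃, -, hX⟩ := Φ.lin_toAlgHom_X
    have h2 : 1 ≠ Fintype.card Fq ^ 2 := (Nat.one_lt_pow two_ne_zero hq).ne
    rw [hX, coeff_add, coeff_add, coeff_C_mul, coeff_C_mul_X_pow, coeff_C_mul_X_pow,
      if_neg hq.ne, if_neg h2, coeff_X_one, mul_one, add_zero, add_zero]

lemma natDegree_lin_toAlgHom_X :
    (lin (Φ.toAlgHom X)).natDegree = Fintype.card Fq ^ 2 := by
  have hq := Fintype.one_lt_card (α := Fq)
  obtain ⟨a₂, a₃, h, hX⟩ := Φ.lin_toAlgHom_X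
  have h2 : Fintype.card Fq < Fintype.card Fq ^ 2 := by nlinarith
  rw [hX, natDegree_add_eq_right_of_natDegree_lt, natDegree_C_mul_X_pow _ _ h]
  rw [natDegree_C_mul_X_pow _ _ h]
  refine lt_of_le_of_lt (natDegree_add_le _ _) (max_lt ?_ ?_)
  · exact lt_of_le_of_lt ((natDegree_C_mul_le _ _).trans natDegree_X_le) (hq.trans h2)
  · exact lt_of_le_of_lt (natDegree_C_mul_X_pow_le _ _) h2

/-- Horner induction: degrees multiply under composition, so each factor `T` contributes `q ^ 2`,
and the added constant only affects the linear term. -/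
lemma natDegree_lin_toAlgHom {a : Fq[X]} (ha : a ≠ 0) :
    (lin (Φ.toAlgHom a)).natDegree = Fintype.card Fq ^ (2 * a.natDegree) := by
  have hq := Fintype.one_lt_card (α := Fq)
  induction hN : a.natDegree generalizing a with
  | zero =>
    rw [eq_C_of_natDegree_eq_zero hN] at ha ⊢
    rw [lin_toAlgHom_C, mul_zero, pow_zero, natDegree_C_mul, natDegree_X]
    exact (_root_.map_ne_zero _).2 (fun h => ha (by rw [h, C_0]))
  | succ n ih =>
    have hdX : a.divX.natDegree = n := by rw [natDegree_divX_eq_natDegree_tsub_one, hN]; rfl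
    have h0 : a.divX ≠ 0 := by
      intro h
      rw [divX_eq_zero_iff] at h
      rw [h, natDegree_C] at hN
      omega
    have h1 : (lin (Φ.toAlgHom (a.divX * X))).natDegree = Fintype.card Fq ^ (2 * (n + 1)) := by
      rw [map_mul, natDegree_lin_mul, ih h0 hdX, natDegree_lin_toAlgHom_X, ← pow_add, mul_add]
    conv_lhs => rw [← divX_mul_X_add a, map_add, map_add]
    rw [natDegree_add_eq_left_of_natDegree_lt, h1]
    rw [h1, lin_toAlgHom_C]
    exact lt_of_le_of_lt ((natDegree_C_mul_le _ _).trans natDegree_X_le) (Nat.one_lt_pow (by omega) hq)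

lemma toAlgHom_injective : Function.Injective Φ.toAlgHom := by
  refine (injective_iff_map_eq_zero _).2 fun a h => by_contra fun ha => ?_
  have := Φ.natDegree_lin_toAlgHom ha
  rw [h, map_zero, natDegree_zero] at this
  exact pow_ne_zero _ Fintype.card_ne_zero this.symm

end DrinfeldModuleRankTwo

/-! ### The action of `L[T]` on `L{τ}` and the quadratic equation of `F` -/

namespace OrePoly

variable {Fq L : Type*} [Field Fq] [Fintype Fq] [Field L] [Algebra Fq L]

lemma smul_eq_C_mul (a : FrobField Fq L) (u : OrePoly Fq L) : a • u = SkewPolynomial.C a * u := by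
  induction u using induction_add with
  | h0 => simp
  | hadd u v hu hv => rw [smul_add, hu, hv, mul_add]
  | hm k b => rw [SkewPolynomial.C_mul_monomial, SkewPolynomial.smul_monomial, smul_eq_mul]

lemma tau_mul_smul (a : FrobField Fq L) (u : OrePoly Fq L) :
    tau Fq L * a • u = SkewPolynomial.φ a • (tau Fq L * u) := by
  rw [smul_eq_C_mul, smul_eq_C_mul, ← mul_assoc, ← mul_assoc]
  congr 1
  rw [← SkewPolynomial.monomial_zero_left, tau, SkewPolynomial.X_mul_monomial,
    ← SkewPolynomial.monomial_zero_left, SkewPolynomial.monomial_mul_X]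

lemma algebraMap_smul (c : Fq) (u : OrePoly Fq L) :
    algebraMap Fq (FrobField Fq L) c • u = c • u := by
  apply lin_injective
  rw [map_smul lin c u, smul_eq_C_mul, lin_mul, Algebra.smul_def]
  have := lin_const (Fq := Fq) (algebraMap Fq L c)
  rw [show (lin (SkewPolynomial.C ((algebraMap Fq (FrobField Fq L)) c) : OrePoly Fq L)) = _ from
    this, mul_comp, C_comp, X_comp]
  rfl

/-- `X ^ q - X` already splits over `Fq`, so a larger field adds no roots. -/
lemma mem_range_algebraMap_of_φ_eq {x : FrobField Fq L} (hx : SkewPolynomial.φ x = x) :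
    x ∈ (algebraMap Fq (FrobField Fq L)).range := by
  have h1 : x ^ Fintype.card Fq = x := by
    have : x ^ Fintype.card Fq ^ 1 = x := hx
    rwa [pow_one] at this
  have hne : (X ^ Fintype.card Fq - X : (FrobField Fq L)[X]) ≠ 0 :=
    FiniteField.X_pow_card_sub_X_ne_zero _ Fintype.one_lt_card
  have hs : (X ^ Fintype.card Fq - X : Fq[X]).Splits := by
    rw [splits_iff_card_roots, FiniteField.roots_X_pow_card_sub_X,
      FiniteField.X_pow_card_sub_X_natDegree_eq _ Fintype.one_lt_card]
    rfl
  have hr := hs.roots_map (algebraMap Fq (FrobField Fq L))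
  rw [Polynomial.map_sub, Polynomial.map_pow, map_X] at hr
  have hx : x ∈ (X ^ Fintype.card Fq - X : (FrobField Fq L)[X]).roots := by
    rw [mem_roots hne, IsRoot.def, eval_sub, eval_pow, eval_X, h1, sub_self]
  rw [hr, Multiset.mem_map] at hx
  obtain ⟨c, -, hc⟩ := hx
  exact ⟨c, hc⟩

variable {γ : Fq[X] →ₐ[Fq] L} (Φ : DrinfeldModuleRankTwo Fq L γ)

/-- The ring `L[T]` acts on `L{τ}`, with `L` acting on the left and `T` by right multiplication
by `Φ_T`. -/
noncomputable def motive : (FrobField Fq L)[X] →ₐ[FrobField Fq L]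
    Module.End (FrobField Fq L) (OrePoly Fq L) :=
  aeval (LinearMap.mulRight (FrobField Fq L) (Φ.toAlgHom X))

lemma motive_X (w : OrePoly Fq L) : motive Φ X w = w * Φ.toAlgHom X := by
  rw [motive, aeval_X, LinearMap.mulRight_apply]

lemma motive_C (a : FrobField Fq L) (w : OrePoly Fq L) : motive Φ (C a) w = a • w := by
  rw [motive, aeval_C, Module.algebraMap_end_apply]

/-- Left multiplication by `τ` commutes with right multiplication by `Φ_T` and twists scalars of
`L`: it is semilinear over `L[T]`. -/
lemma tau_mul_motive (x : (FrobField Fq L)[X]) (w : OrePoly Fq L) :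
    tau Fq L * motive Φ x w = motive Φ (x.map SkewPolynomial.φ) (tau Fq L * w) := by
  induction x using Polynomial.induction_on generalizing w with
  | C a => rw [motive_C, map_C, motive_C, tau_mul_smul]
  | add x y hx hy =>
    simp only [map_add, LinearMap.add_apply, mul_add, hx, hy, Polynomial.map_add]
  | monomial n a h =>
    rw [pow_succ, ← mul_assoc, map_mul, Module.End.mul_apply, h, Polynomial.map_mul _ (q := X), map_X,
      map_mul (motive Φ) _ X, Module.End.mul_apply, motive_X, motive_X, mul_assoc]

lemma motive_map (a : Fq[X]) (w : OrePoly Fq L) :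
    motive Φ (a.map (algebraMap Fq _)) w = w * Φ.toAlgHom a := by
  induction a using Polynomial.induction_on generalizing w with
  | C c =>
    rw [map_C, motive_C, algebraMap_smul, show (C c : Fq[X]) = algebraMap Fq Fq[X] c from rfl,
      AlgHom.commutes, ← Algebra.commutes, Algebra.smul_def]
  | add x y hx hy =>
    simp only [map_add, LinearMap.add_apply, mul_add, hx, hy, Polynomial.map_add]
  | monomial n a h =>
    rw [pow_succ, ← mul_assoc, Polynomial.map_mul, map_X, map_mul, Module.End.mul_apply, motive_X,
      h, mul_comm _ X, map_mul Φ.toAlgHom X, mul_assoc]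

/-- The element `v₀ + v₁ τ` of `L{τ}`, for `v₀, v₁ ∈ L[T]`. -/
noncomputable def motiveComb (v : Fin 2 → (FrobField Fq L)[X]) : OrePoly Fq L :=
  motive Φ (v 0) 1 + motive Φ (v 1) (tau Fq L)

lemma motiveComb_add (v w : Fin 2 → (FrobField Fq L)[X]) :
    motiveComb Φ (v + w) = motiveComb Φ v + motiveComb Φ w := by
  simp only [motiveComb, Pi.add_apply, map_add, LinearMap.add_apply]
  abel

lemma motiveComb_smul (x : (FrobField Fq L)[X]) (v : Fin 2 → (FrobField Fq L)[X]) :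
    motiveComb Φ (x • v) = motive Φ x (motiveComb Φ v) := by
  simp only [motiveComb, Pi.smul_apply, smul_eq_mul, map_mul, Module.End.mul_apply, map_add]

/-- Solving `Φ_T = t + a₂ τ + a₃ τ ^ 2` for `τ ^ 2`, with `b = 1 / a₃`, gives `τ ^ 2 = b (T - t) · 1
- b a₂ · τ`. The columns of `B` are the coordinates of `τ · 1` and `τ · τ`, and its determinant is
`-b (T - t)`. -/
lemma exists_tau_matrix : ∃ B : Matrix (Fin 2) (Fin 2) (FrobField Fq L)[X], B.det ≠ 0 ∧
    ∀ v, tau Fq L * motiveComb Φ v =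
      motiveComb Φ (B.mulVec (mapRingHom SkewPolynomial.φ ∘ v)) := by
  obtain ⟨a₂, a₃, ha, hX⟩ := Φ.rank_two
  set b : FrobField Fq L := ((FrobField.equiv Fq L).symm a₃)⁻¹ with hb
  have hb0 : (FrobField.equiv Fq L).symm a₃ ≠ 0 := (map_ne_zero_iff _ (AlgEquiv.injective _)).2 ha
  set t : FrobField Fq L := (FrobField.equiv Fq L).symm (γ X)
  set c : FrobField Fq L := (FrobField.equiv Fq L).symm a₂
  have hsq : tau Fq L * tau Fq L = motiveComb Φ ![C b * (X - C t), C (-(b * c))] := by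
    have h1 : b • Φ.toAlgHom X = b • (SkewPolynomial.C t : OrePoly Fq L) +
        (b * c) • tau Fq L + tau Fq L * tau Fq L := by
      rw [hX, smul_add, smul_add]
      congr 1
      · congr 1
        rw [mul_smul, smul_eq_C_mul c]
        rfl
      · rw [const, ← smul_eq_C_mul, smul_smul, hb, inv_mul_cancel₀ hb0, one_smul, sq]
    rw [motiveComb, Matrix.cons_val_zero, Matrix.cons_val_one, Matrix.cons_val_fin_one,
      map_mul, Module.End.mul_apply, motive_C, motive_C, map_sub, LinearMap.sub_apply, motive_X,
      motive_C, one_mul, smul_sub, h1, smul_eq_C_mul t, mul_one, neg_smul]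
    abel
  refine ⟨!![0, C b * (X - C t); 1, C (-(b * c))], ?_, fun v => ?_⟩
  · rw [Matrix.det_fin_two_of, zero_mul, zero_sub, mul_one, neg_ne_zero]
    exact mul_ne_zero (C_ne_zero.2 (inv_ne_zero hb0)) (X_sub_C_ne_zero t)
  · have hv : Matrix.mulVec !![0, C b * (X - C t); 1, C (-(b * c))]
        (mapRingHom SkewPolynomial.φ ∘ v) = (v 0).map SkewPolynomial.φ • ![0, 1] +
        (v 1).map SkewPolynomial.φ • ![C b * (X - C t), C (-(b * c))] := by
      ext i : 1
      fin_cases i <;> simp [Matrix.mulVec, Matrix.vecHead, Matrix.vecTail, mul_comm]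
    rw [hv, motiveComb_add, motiveComb_smul, motiveComb_smul, ← hsq, motiveComb, mul_add,
      tau_mul_motive, tau_mul_motive, motiveComb]
    simp

/-- The matrix `B σ(B) ⋯ σ ^ (k - 1)(B)`. -/
noncomputable def cocycle {R ι : Type*} [CommRing R] [Fintype ι] [DecidableEq ι] (σ : R →+* R)
    (B : Matrix ι ι R) : ℕ → Matrix ι ι R
  | 0 => 1
  | k + 1 => B * σ.mapMatrix (cocycle σ B k)

lemma cocycle_succ {R ι : Type*} [CommRing R] [Fintype ι] [DecidableEq ι] (σ : R →+* R)
    (B : Matrix ι ι R) (k : ℕ) :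
    cocycle σ B (k + 1) = cocycle σ B k * σ.mapMatrix^[k] B := by
  induction k with
  | zero => simp [cocycle]
  | succ k ih =>
    conv_lhs => rw [cocycle, ih, map_mul, ← mul_assoc]
    rw [Function.iterate_succ_apply']
    rfl

lemma tau_pow_mul_motiveComb {B : Matrix (Fin 2) (Fin 2) (FrobField Fq L)[X]}
    (hB : ∀ v, tau Fq L * motiveComb Φ v =
      motiveComb Φ (B.mulVec (mapRingHom SkewPolynomial.φ ∘ v))) (k : ℕ)
    (v : Fin 2 → (FrobField Fq L)[X]) :
    tau Fq L ^ k * motiveComb Φ v = motiveComb Φ ((cocycle (mapRingHom SkewPolynomial.φ) B k).mulVec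
      ((mapRingHom SkewPolynomial.φ)^[k] ∘ v)) := by
  induction k with
  | zero => simp [cocycle]
  | succ k ih =>
    rw [pow_succ', mul_assoc, ih, hB, cocycle, ← Matrix.mulVec_mulVec]
    congr 2
    ext i : 1
    rw [Function.comp_apply, RingHom.map_mulVec, Function.iterate_succ', RingHom.mapMatrix_apply]
    rfl

end OrePoly

/-- `B` intertwines `D` and `C` but need not be invertible over `R`. For the trace, multiply by the
adjugate of `B` and cancel `det B`. -/
lemma Matrix.det_eq_and_trace_eq_of_mul_eq_mul {R : Type*} [CommRing R] [IsDomain R]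
    {B C D : Matrix (Fin 2) (Fin 2) R} (hB : B.det ≠ 0) (h : B * D = C * B) :
    D.det = C.det ∧ D.trace = C.trace := by
  constructor
  · have := congrArg Matrix.det h
    rw [Matrix.det_mul, Matrix.det_mul, mul_comm C.det] at this
    exact mul_left_cancel₀ hB this
  · have : (B.adjugate * (B * D)).trace = (B.adjugate * (C * B)).trace := by rw [h]
    rw [← mul_assoc, Matrix.adjugate_mul, smul_mul_assoc, one_mul, Matrix.trace_smul,
      ← mul_assoc, Matrix.trace_mul_comm, ← mul_assoc, Matrix.mul_adjugate, smul_mul_assoc,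
      one_mul, Matrix.trace_smul] at this
    exact mul_left_cancel₀ hB this

namespace OrePoly

variable {Fq L : Type*} [Field Fq] [Fintype Fq] [Field L] [Algebra Fq L]

lemma exists_map_eq_of_map_φ_eq {x : (FrobField Fq L)[X]} (hx : x.map SkewPolynomial.φ = x) :
    ∃ a : Fq[X], a.map (algebraMap Fq _) = x := by
  rw [← mem_lifts, lifts_iff_coeff_lifts]
  intro k
  refine mem_range_algebraMap_of_φ_eq ?_
  rw [← coeff_map, hx]

lemma mapRingHom_φ_iterate_finrank [Finite L] :
    (mapRingHom (SkewPolynomial.φ (R := FrobField Fq L)))^[Module.finrank Fq L] = id := by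
  have := Fintype.ofFinite L
  have h (k : ℕ) (x : (FrobField Fq L)[X]) (i : ℕ) :
      ((mapRingHom (SkewPolynomial.φ (R := FrobField Fq L)))^[k] x).coeff i =
        (SkewPolynomial.φ (R := FrobField Fq L))^[k] (x.coeff i) := by
    induction k with
    | zero => rfl
    | succ k ih =>
      rw [Function.iterate_succ_apply', Function.iterate_succ_apply', ← ih, coe_mapRingHom,
        coeff_map]
  ext x i
  rw [h, SkewPolynomial.φ_iterate_apply, FrobField.smul_def, toAdd_ofAdd,
    ← Module.card_eq_pow_finrank (K := Fq) (V := L)]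
  exact FiniteField.pow_card (K := L) _

/-- The Frobenius satisfies a monic quadratic equation over `Fq[T]`. -/
theorem exists_frobenius_quadratic [Finite L] {γ : Fq[X] →ₐ[Fq] L}
    (Φ : DrinfeldModuleRankTwo Fq L γ) : ∃ c N : Fq[X],
      (tau Fq L ^ Module.finrank Fq L) ^ 2 - tau Fq L ^ Module.finrank Fq L * Φ.toAlgHom c +
        Φ.toAlgHom N = 0 := by
  obtain ⟨B, hdet, hB⟩ := exists_tau_matrix Φ
  set σ := mapRingHom (SkewPolynomial.φ (R := FrobField Fq L)) with hσ
  set n := Module.finrank Fq L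
  set M := cocycle σ B n with hM
  have hσn : σ^[n] = id := mapRingHom_φ_iterate_finrank
  -- Both sides are the twisted product of `n + 1` factors, split off at its first or its last
  -- factor; the last is `σ ^ n (B) = B`. So `M` and `σ(M)` have the same trace and determinant,
  -- which therefore have coefficients in `Fq`.
  have hMB : B * σ.mapMatrix M = M * B := by
    have h1 : σ.mapMatrix^[n] B = B := by
      have (k : ℕ) : σ.mapMatrix^[k] B = B.map σ^[k] := by
        induction k with
        | zero => simp
        | succ k ih => rw [Function.iterate_succ_apply', ih, Function.iterate_succ']; rfl
      rw [this, hσn, Matrix.map_id]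
    have h2 := cocycle_succ σ B n
    rwa [h1] at h2
  obtain ⟨h1, h2⟩ := Matrix.det_eq_and_trace_eq_of_mul_eq_mul hdet hMB
  rw [← RingHom.map_det] at h1
  rw [Matrix.trace_fin_two, RingHom.mapMatrix_apply, Matrix.map_apply, Matrix.map_apply, ← map_add,
    ← Matrix.trace_fin_two] at h2
  obtain ⟨N, hN⟩ := exists_map_eq_of_map_φ_eq h1
  obtain ⟨c, hc⟩ := exists_map_eq_of_map_φ_eq h2
  have hF (v) : tau Fq L ^ n * motiveComb Φ v = motiveComb Φ (M.mulVec v) := by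
    rw [tau_pow_mul_motiveComb Φ hB, ← hσ, hσn, Function.id_comp]
  have hone : motiveComb Φ ![1, 0] = 1 := by simp [motiveComb]
  -- Cayley-Hamilton is needed only on the vector representing `1`; that `1, τ` is a basis over
  -- `L[T]` plays no role.
  have hCH : M.mulVec (M.mulVec ![1, 0]) + (-1 : (FrobField Fq L)[X]) • M.trace • M.mulVec ![1, 0] +
      M.det • ![1, 0] = 0 := by
    ext i : 1
    fin_cases i <;>
    · simp [Matrix.vecHead, Matrix.vecTail, Matrix.det_fin_two, Matrix.trace_fin_two]
      ring
  refine ⟨c, N, ?_⟩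
  have := congrArg (motiveComb Φ) hCH
  rw [motiveComb_add, motiveComb_add, motiveComb_smul, motiveComb_smul, motiveComb_smul, ← hF,
    ← hF, hone, ← hN, ← hc, motive_map, motive_map, map_neg, map_one, LinearMap.neg_apply,
    Module.End.one_apply, mul_one, ← sq, one_mul, ← sub_eq_add_neg] at this
  refine Eq.trans this ?_
  simp [motiveComb]

end OrePoly

/-! ### Finding `(A/r)²` from the sizes of torsion submodules -/

section TorsionCount

variable {A M : Type*} [CommRing A] [AddCommGroup M] [Module A M]

/-- The `p`-torsion has two independent elements by its size. Comparing the `p ^ (e + 1)`- and `p ^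
e`-torsion shows that `p ^ e` maps the former onto the `p`-torsion; lifts of the two elements are
independent modulo `p ^ (e + 1)`, one factor `p` at a time. -/
lemma exists_independent_of_prime_pow [IsDomain A] [IsPrincipalIdealRing A] {p : A}
    (hp : Prime p) (e : ℕ) [Finite (A ⧸ Ideal.span {p})]
    (h : ∀ i ≤ e, Nat.card (Submodule.torsionBy A M (p ^ i)) =
      (Nat.card (A ⧸ Ideal.span {p})) ^ (2 * i)) :
    ∃ m₁ m₂ : M, p ^ e • m₁ = 0 ∧ p ^ e • m₂ = 0 ∧
      ∀ a b : A, a • m₁ + b • m₂ = 0 → p ^ e ∣ a ∧ p ^ e ∣ b := by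
  rcases e with _ | e
  · exact ⟨0, 0, by simp, by simp, by simp⟩
  set κ := Nat.card (A ⧸ Ideal.span {p})
  have hκ : 1 < κ := by
    have : Nontrivial (A ⧸ Ideal.span {p}) :=
      Ideal.Quotient.nontrivial_iff.2 (mt Ideal.span_singleton_eq_top.1 hp.not_isUnit)
    exact Finite.one_lt_card
  have hfin (i : ℕ) (hi : i ≤ e + 1) : Finite (Submodule.torsionBy A M (p ^ i)) :=
    Nat.finite_of_card_ne_zero (by rw [h i hi]; positivity)
  have h1 : Nat.card (Submodule.torsionBy A M p) = κ ^ 2 := by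
    have := h 1 (by omega)
    rwa [pow_one] at this
  have := hfin 1 (by omega)
  rw [pow_one] at this
  -- two independent elements of the `p`-torsion
  obtain ⟨y₁, hy₁, hy₁0⟩ : ∃ y ∈ Submodule.torsionBy A M p, y ≠ 0 := by
    by_contra! hc
    have h2 : Submodule.torsionBy A M p = ⊥ := (Submodule.eq_bot_iff _).2 hc
    rw [h2, Nat.card_unique] at h1
    nlinarith
  obtain ⟨y₂, hy₂, hy₂1⟩ : ∃ y ∈ Submodule.torsionBy A M p, y ∉ Submodule.span A {y₁} := by
    -- Otherwise the `p`-torsion would be covered by `A/p`, which has only `κ < κ ^ 2` elements.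
    by_contra! hc
    have hle : Nat.card (Submodule.torsionBy A M p) ≤ κ := by
      let f : (A ⧸ Ideal.span {p}) →ₗ[A] M := Submodule.liftQ _ (LinearMap.toSpanSingleton A M y₁)
        (by
          refine (Submodule.span_singleton_le_iff_mem _ _).2 ?_
          simpa using hy₁)
      have hf : ∀ y ∈ Submodule.torsionBy A M p, ∃ z, f z = y := by
        intro y hy
        obtain ⟨a, ha⟩ := Submodule.mem_span_singleton.1 (hc y hy)
        exact ⟨Submodule.Quotient.mk a, ha⟩
      choose g hg using hf
      refine Nat.card_le_card_of_injective (fun y : Submodule.torsionBy A M p => g y y.2) ?_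
      intro y z hyz
      apply Subtype.ext
      rw [← hg y y.2, ← hg z z.2]
      exact congrArg f hyz
    rw [h1] at hle
    nlinarith
  have hind (a b : A) (hab : a • y₁ + b • y₂ = 0) : p ∣ a ∧ p ∣ b := by
    have key (a : A) (z : M) (hz : p • z = 0) (W : Submodule A M) (h : a • z ∈ W) (hzW : z ∉ W) :
        p ∣ a := by
      by_contra hpa
      obtain ⟨u, v, huv⟩ := (hp.irreducible.coprime_iff_not_dvd).2 hpa
      refine hzW ?_
      rw [← one_smul A z, ← huv, add_smul, mul_smul, hz, smul_zero, zero_add, mul_smul]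
      exact W.smul_mem _ h
    have hb : p ∣ b := key b y₂ hy₂ _ (Submodule.mem_span_singleton.2
      ⟨-a, by rw [neg_smul]; exact neg_eq_of_add_eq_zero_right hab⟩) hy₂1
    obtain ⟨b', rfl⟩ := hb
    rw [mul_comm, mul_smul, (Submodule.mem_torsionBy_iff p y₂).1 hy₂, smul_zero, add_zero] at hab
    exact ⟨key a y₁ hy₁ ⊥ ((Submodule.mem_bot A).2 hab) (by simpa using hy₁0), dvd_mul_right _ _⟩
  -- multiplication by `p ^ e` is onto the `p`-torsion
  have hsurj : ∀ y ∈ Submodule.torsionBy A M p, ∃ m, p ^ (e + 1) • m = 0 ∧ p ^ e • m = y := by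
    let f : Submodule.torsionBy A M (p ^ (e + 1)) →ₗ[A] M :=
      (LinearMap.lsmul A M (p ^ e)).comp (Submodule.subtype _)
    have hker : Nat.card (LinearMap.ker f) = κ ^ (2 * e) := by
      rw [← h e (by omega)]
      refine Nat.card_congr ⟨fun x => ⟨x.1, x.2⟩, fun x => ⟨⟨x.1, ?_⟩, x.2⟩, fun _ => rfl,
        fun _ => rfl⟩
      rw [Submodule.mem_torsionBy_iff, pow_succ', mul_smul, (Submodule.mem_torsionBy_iff _ _).1 x.2,
        smul_zero]
    have hcard := Submodule.card_eq_card_quotient_mul_card (LinearMap.ker f)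
    rw [h (e + 1) le_rfl, hker, Nat.card_congr f.quotKerEquivRange.toEquiv, mul_add, mul_one,
      pow_add] at hcard
    have hr : Nat.card (LinearMap.range f) = κ ^ 2 :=
      (Nat.eq_of_mul_eq_mul_left (pow_pos (by omega : 0 < κ) (2 * e)) hcard).symm
    have hle : LinearMap.range f ≤ Submodule.torsionBy A M p := by
      rintro _ ⟨x, rfl⟩
      rw [Submodule.mem_torsionBy_iff]
      change p • p ^ e • (x : M) = 0
      rw [← mul_smul, ← pow_succ']
      exact x.2
    have heq : LinearMap.range f = Submodule.torsionBy A M p := by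
      apply SetLike.coe_injective
      refine Set.eq_of_subset_of_ncard_le hle ?_ (Set.toFinite _)
      rw [← Nat.card_coe_set_eq, ← Nat.card_coe_set_eq]
      exact (h1.trans hr.symm).le
    intro y hy
    rw [← heq] at hy
    obtain ⟨x, rfl⟩ := hy
    exact ⟨x, x.2, rfl⟩
  obtain ⟨m₁, hm₁, hm₁y⟩ := hsurj y₁ hy₁
  obtain ⟨m₂, hm₂, hm₂y⟩ := hsurj y₂ hy₂
  refine ⟨m₁, m₂, hm₁, hm₂, fun a b hab => ?_⟩
  have hstep (i : ℕ) (hi : i ≤ e + 1) : p ^ i ∣ a ∧ p ^ i ∣ b := by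
    induction i with
    | zero => simp
    | succ i ih =>
      obtain ⟨⟨a', rfl⟩, ⟨b', rfl⟩⟩ := ih (by omega)
      -- With `j = e - i`, multiplying the relation by `p ^ j` turns `p ^ i • m` into `y`.
      obtain ⟨j, rfl⟩ := Nat.exists_eq_add_of_le (show i ≤ e by omega)
      have h3 : a' • y₁ + b' • y₂ = 0 := by
        rw [← hm₁y, ← hm₂y, smul_smul, smul_smul,
          show a' * p ^ (i + j) = p ^ j * (p ^ i * a') by ring,
          show b' * p ^ (i + j) = p ^ j * (p ^ i * b') by ring, mul_smul (p ^ j),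
          mul_smul (p ^ j), ← smul_add, hab, smul_zero]
      obtain ⟨h4, h5⟩ := hind a' b' h3
      exact ⟨pow_succ p i ▸ mul_dvd_mul_left _ h4, pow_succ p i ▸ mul_dvd_mul_left _ h5⟩
  exact hstep _ le_rfl

/-- Add the two pairs: multiplying a relation by `y` removes the `y`-torsion part, and coprimality
then removes the factor `y`. -/
lemma exists_independent_mul {x y : A} (hxy : IsCoprime x y)
    (hx : ∃ m₁ m₂ : M, x • m₁ = 0 ∧ x • m₂ = 0 ∧ ∀ a b : A, a • m₁ + b • m₂ = 0 → x ∣ a ∧ x ∣ b)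
    (hy : ∃ m₁ m₂ : M, y • m₁ = 0 ∧ y • m₂ = 0 ∧ ∀ a b : A, a • m₁ + b • m₂ = 0 → y ∣ a ∧ y ∣ b) :
    ∃ m₁ m₂ : M, (x * y) • m₁ = 0 ∧ (x * y) • m₂ = 0 ∧
      ∀ a b : A, a • m₁ + b • m₂ = 0 → x * y ∣ a ∧ x * y ∣ b := by
  obtain ⟨m₁, m₂, h₁, h₂, h⟩ := hx
  obtain ⟨n₁, n₂, k₁, k₂, k⟩ := hy
  have h0 (z m : M) (hm : x • m = 0) (hz : y • z = 0) : (x * y) • (m + z) = 0 := by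
    rw [smul_add, mul_smul x y z, hz, mul_comm, mul_smul, hm, smul_zero, smul_zero, add_zero]
  refine ⟨m₁ + n₁, m₂ + n₂, h0 _ _ h₁ k₁, h0 _ _ h₂ k₂, fun a b hab => ?_⟩
  have hx : x ∣ y * a ∧ x ∣ y * b := h _ _ <| by
    have h3 := congrArg (y • ·) hab
    have e1 : (y * a) • n₁ = 0 := by rw [mul_comm, mul_smul, k₁, smul_zero]
    have e2 : (y * b) • n₂ = 0 := by rw [mul_comm, mul_smul, k₂, smul_zero]
    simpa only [smul_add, smul_smul, e1, e2, add_zero, smul_zero] using h3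
  have hy : y ∣ x * a ∧ y ∣ x * b := k _ _ <| by
    have h3 := congrArg (x • ·) hab
    have e1 : (x * a) • m₁ = 0 := by rw [mul_comm, mul_smul, h₁, smul_zero]
    have e2 : (x * b) • m₂ = 0 := by rw [mul_comm, mul_smul, h₂, smul_zero]
    simpa only [smul_add, smul_smul, e1, e2, zero_add, smul_zero] using h3
  exact ⟨hxy.mul_dvd (hxy.dvd_of_dvd_mul_left hx.1) (hxy.symm.dvd_of_dvd_mul_left hy.1),
    hxy.mul_dvd (hxy.dvd_of_dvd_mul_left hx.2) (hxy.symm.dvd_of_dvd_mul_left hy.2)⟩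

lemma exists_injective_of_independent {r : A} {m₁ m₂ : M} (h₁ : r • m₁ = 0) (h₂ : r • m₂ = 0)
    (h : ∀ a b : A, a • m₁ + b • m₂ = 0 → r ∣ a ∧ r ∣ b) :
    ∃ f : ((A ⧸ Ideal.span {r}) × (A ⧸ Ideal.span {r})) →ₗ[A] M,
      Function.Injective f := by
  have hle {m : M} (hm : r • m = 0) :
      Ideal.span {r} ≤ LinearMap.ker (LinearMap.toSpanSingleton A M m) :=
    (Submodule.span_singleton_le_iff_mem _ _).2 (by simpa using hm)
  refine ⟨LinearMap.coprod (Submodule.liftQ _ _ (hle h₁)) (Submodule.liftQ _ _ (hle h₂)),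
    (injective_iff_map_eq_zero _).2 ?_⟩
  rintro ⟨a, b⟩ hab
  obtain ⟨a, rfl⟩ := Submodule.Quotient.mk_surjective _ a
  obtain ⟨b, rfl⟩ := Submodule.Quotient.mk_surjective _ b
  obtain ⟨ha, hb⟩ := h a b hab
  rw [Prod.mk_eq_zero, Submodule.Quotient.mk_eq_zero, Submodule.Quotient.mk_eq_zero]
  exact ⟨Ideal.mem_span_singleton.2 ha, Ideal.mem_span_singleton.2 hb⟩

end TorsionCount

section PolynomialTorsionCount

variable {Fq M : Type*} [Field Fq] [Fintype Fq] [AddCommGroup M] [Module Fq[X] M]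

lemma finite_quotient_span {d : Fq[X]} (hd : d ≠ 0) : Finite (Fq[X] ⧸ Ideal.span {d}) := by
  have : Module.Finite Fq (Fq[X] ⧸ Ideal.span {d}) :=
    Module.Finite.of_basis (AdjoinRoot.powerBasis hd).basis
  exact Module.finite_of_finite Fq

lemma card_quotient_span {d : Fq[X]} (hd : d ≠ 0) :
    Nat.card (Fq[X] ⧸ Ideal.span {d}) = Fintype.card Fq ^ d.natDegree := by
  have : Module.Finite Fq (Fq[X] ⧸ Ideal.span {d}) :=
    Module.Finite.of_basis (AdjoinRoot.powerBasis hd).basis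
  have hr : Module.finrank Fq (Fq[X] ⧸ Ideal.span {d}) = d.natDegree :=
    (AdjoinRoot.powerBasis hd).finrank.trans (AdjoinRoot.powerBasis_dim hd)
  rw [Module.natCard_eq_pow_finrank (K := Fq), hr, Nat.card_eq_fintype_card]

/-- The count is required at every divisor: for `r = p ^ 2` the count at `r` alone would also allow
`(A/p)⁴`. -/
lemma exists_independent_of_card_torsionBy {r : Fq[X]} (hr : r ≠ 0)
    (h : ∀ d, d ∣ r →
      Nat.card (Submodule.torsionBy Fq[X] M d) = Fintype.card Fq ^ (2 * d.natDegree)) :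
    ∃ m₁ m₂ : M, r • m₁ = 0 ∧ r • m₂ = 0 ∧
      ∀ a b : Fq[X], a • m₁ + b • m₂ = 0 → r ∣ a ∧ r ∣ b := by
  induction r using UniqueFactorizationMonoid.induction_on_coprime with
  | h0 => exact absurd rfl hr
  | h1 hu => exact ⟨0, 0, smul_zero _, smul_zero _, fun a b _ => ⟨hu.dvd, hu.dvd⟩⟩
  | @hpr p e hp =>
    have := finite_quotient_span hp.ne_zero
    refine exists_independent_of_prime_pow hp e fun i hi => ?_
    rw [h _ (pow_dvd_pow p hi), card_quotient_span hp.ne_zero, natDegree_pow, ← pow_mul]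
    ring_nf
  | hcp hxy hx hy =>
    exact exists_independent_mul (hxy.isCoprime)
      (hx (left_ne_zero_of_mul hr) fun d hd => h d (hd.mul_right _))
      (hy (right_ne_zero_of_mul hr) fun d hd => h d (hd.mul_left _))

end PolynomialTorsionCount

/-! ### Orders in a quadratic algebra and their discriminants -/

section QuadraticOrder

variable {A K E : Type*} [CommRing A] [Field K] [Algebra A K] [Ring E] [Algebra K E] [Algebra A E]

lemma smul_one_add_smul_smul_sub_one (x y r : K) (f : E) :
    x • (1 : E) + y • r • (f - 1) = (x - y * r) • (1 : E) + (y * r) • f := by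
  module

lemma algebraMap_smul_eq [IsScalarTower A K E] (a : A) (z : E) : algebraMap A K a • z = a • z :=
  algebraMap_smul K a z

/-- The determinant of the trace form of an algebra in a given basis. -/
noncomputable def basisDisc {S : Type*} [Ring S] [Algebra A S] (b : Module.Basis (Fin 2) A S) : A :=
  (Matrix.of fun i j => LinearMap.trace A S (LinearMap.mulLeft A (b i * b j))).det

/-- A basis over `A` stays independent over the fraction field `K`, while a kernel vector of its
coordinate matrix would be a `K`-linear relation. -/
lemma det_coord_ne_zero [IsScalarTower A K E] [IsFractionRing A K] {g : E} {O : Subalgebra A E}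
    {b : Module.Basis (Fin 2) A O} {x y : Fin 2 → K}
    (hb : ∀ i, (b i : E) = x i • (1 : E) + y i • g) :
    (!![x 0, x 1; y 0, y 1]).det ≠ 0 := by
  intro h0
  obtain ⟨v, hv, hv0⟩ := Matrix.exists_mulVec_eq_zero_iff.2 h0
  have h1 : LinearIndependent A (fun i => (b i : E)) :=
    b.linearIndependent.map' O.val.toLinearMap (LinearMap.ker_eq_bot.2 Subtype.val_injective)
  have h2 : LinearIndependent K (fun i => (b i : E)) :=
    (LinearIndependent.iff_fractionRing A K).1 h1
  refine hv (funext fun i => Fintype.linearIndependent_iff.1 h2 v ?_ i)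
  have e0 := congrFun hv0 0
  have e1 := congrFun hv0 1
  simp only [Matrix.mulVec, dotProduct, Fin.sum_univ_two, Matrix.of_apply, Matrix.cons_val',
    Matrix.cons_val_zero, Matrix.cons_val_one, Matrix.cons_val_fin_one, Pi.zero_apply] at e0 e1
  rw [Fin.sum_univ_two, hb, hb]
  calc v 0 • (x 0 • (1 : E) + y 0 • g) + v 1 • (x 1 • (1 : E) + y 1 • g)
      = (x 0 * v 0 + x 1 * v 1) • (1 : E) + (y 0 * v 0 + y 1 * v 1) • g := by module
    _ = 0 := by rw [e0, e1, zero_smul, zero_smul, add_zero]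

/-- `g` generates a quadratic `K`-algebra, with `g ^ 2 = t g - m`. -/
structure IsQuadraticGen (K : Type*) {A E : Type*} [CommRing A] [Field K] [Algebra A K] [Ring E]
    [Algebra K E] [Algebra A E] (g : E) (t m : A) : Prop where
  mul_self : g * g = t • g - m • 1
  indep : ∀ x y : K, x • (1 : E) + y • g = 0 → x = 0 ∧ y = 0

namespace IsQuadraticGen

variable {g : E} {t m : A} (hg : IsQuadraticGen K g t m)
include hg

lemma ext {x y x' y' : K} (h : x • (1 : E) + y • g = x' • (1 : E) + y' • g) : x = x' ∧ y = y' := by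
  have := hg.indep (x - x') (y - y') (by
    rw [sub_smul, sub_smul]
    rw [← sub_eq_zero] at h
    rw [← h]; abel)
  exact ⟨sub_eq_zero.1 this.1, sub_eq_zero.1 this.2⟩

variable [IsScalarTower A K E]

lemma mul_eq (x y x' y' : K) :
    (x • (1 : E) + y • g) * (x' • (1 : E) + y' • g) =
      (x * x' - algebraMap A K m * (y * y')) • (1 : E) +
        (x * y' + y * x' + algebraMap A K t * (y * y')) • g := by
  have h1 : (y • g) * (y' • g) = (algebraMap A K t * (y * y')) • g -
      (algebraMap A K m * (y * y')) • (1 : E) := by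
    rw [smul_mul_smul_comm, hg.mul_self, ← algebraMap_smul_eq (K := K) t,
      ← algebraMap_smul_eq (K := K) m, smul_sub, smul_smul, smul_smul, mul_comm (y * y'),
      mul_comm (y * y')]
  rw [add_mul, mul_add, mul_add, h1, smul_mul_smul_comm, smul_mul_smul_comm, smul_mul_smul_comm,
    one_mul, one_mul, mul_one]
  module

/-- The order `A + A g`. -/
noncomputable def order : Subalgebra A E where
  carrier := {z | ∃ a b : A, z = a • (1 : E) + b • g}
  add_mem' := by
    rintro _ _ ⟨a, b, rfl⟩ ⟨c, d, rfl⟩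
    exact ⟨a + c, b + d, by module⟩
  mul_mem' := by
    rintro _ _ ⟨a, b, rfl⟩ ⟨c, d, rfl⟩
    refine ⟨a * c - m * (b * d), a * d + b * c + t * (b * d), ?_⟩
    simp only [← algebraMap_smul_eq (A := A) (K := K)]
    rw [hg.mul_eq]
    simp only [map_add, map_sub, map_mul]
  algebraMap_mem' a := ⟨a, 0, by rw [zero_smul, add_zero, Algebra.algebraMap_eq_smul_one]⟩

lemma mem_order {z : E} : z ∈ hg.order ↔ ∃ a b : A, z = a • (1 : E) + b • g := Iff.rfl

lemma mem_adjoin_singleton_iff {f : E} {x y : K} (hf : f = x • (1 : E) + y • g) (hy : y ≠ 0)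
    {z : E} : z ∈ Algebra.adjoin K {f} ↔ ∃ u v : K, z = u • (1 : E) + v • g := by
  constructor
  · intro hz
    induction hz using Algebra.adjoin_induction with
    | mem z hz => exact ⟨x, y, (Set.mem_singleton_iff.1 hz).trans hf⟩
    | algebraMap a => exact ⟨a, 0, by rw [zero_smul, add_zero, Algebra.algebraMap_eq_smul_one]⟩
    | add p q _ _ hp hq =>
      obtain ⟨a, b, rfl⟩ := hp
      obtain ⟨c, d, rfl⟩ := hq
      exact ⟨a + c, b + d, by module⟩
    | mul p q _ _ hp hq =>
      obtain ⟨a, b, rfl⟩ := hp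
      obtain ⟨c, d, rfl⟩ := hq
      exact ⟨_, _, hg.mul_eq _ _ _ _⟩
  · rintro ⟨u, v, rfl⟩
    have h1 : g = y⁻¹ • (f - x • (1 : E)) := by
      rw [hf, add_sub_cancel_left, smul_smul, inv_mul_cancel₀ hy, one_smul]
    have hfm : f ∈ Algebra.adjoin K {f} := Algebra.subset_adjoin (Set.mem_singleton f)
    have hgm : g ∈ Algebra.adjoin K {f} :=
      h1 ▸ Subalgebra.smul_mem _ (sub_mem hfm (Subalgebra.smul_mem _ (one_mem _) x)) y⁻¹
    exact add_mem (Subalgebra.smul_mem _ (one_mem _) u) (Subalgebra.smul_mem _ hgm v)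

variable [IsFractionRing A K]

variable {O : Subalgebra A E} {b : Module.Basis (Fin 2) A O} {x y : Fin 2 → K}

/-- The coordinate matrix of `b` intertwines multiplication by `z` in the basis `b` with its matrix
in `1, g`, where trace and norm can be read off. -/
lemma trace_det_mulLeft (hb : ∀ i, (b i : E) = x i • (1 : E) + y i • g) (z : O) {u v : K}
    (hz : (z : E) = u • (1 : E) + v • g) :
    algebraMap A K (LinearMap.det (LinearMap.mulLeft A z)) =
      u ^ 2 + algebraMap A K t * u * v + algebraMap A K m * v ^ 2 ∧
    algebraMap A K (LinearMap.trace A O (LinearMap.mulLeft A z)) =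
      2 * u + algebraMap A K t * v := by
  set C := LinearMap.toMatrix b b (LinearMap.mulLeft A z) with hC
  have hcol (j : Fin 2) : (z * b j : E) = ∑ k, algebraMap A K (C k j) • (b k : E) := by
    have := b.sum_repr (z * b j)
    have h2 := congrArg (Subtype.val) this
    rw [← Subalgebra.coe_mul, ← h2, Fin.sum_univ_two, Fin.sum_univ_two]
    simp only [algebraMap_smul_eq, hC, LinearMap.toMatrix_apply, LinearMap.mulLeft_apply]
    rfl
  have hint : !![x 0, x 1; y 0, y 1] * (algebraMap A K).mapMatrix C =
      !![u, -(algebraMap A K m * v); v, u + algebraMap A K t * v] * !![x 0, x 1; y 0, y 1] := by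
    have hcomb (p q : K) : p • (x 0 • (1 : E) + y 0 • g) + q • (x 1 • (1 : E) + y 1 • g) =
        (p * x 0 + q * x 1) • (1 : E) + (p * y 0 + q * y 1) • g := by module
    have key (j : Fin 2) := hg.ext <| (hg.mul_eq u v (x j) (y j)).symm.trans <| by
      have h := hcol j
      rwa [hz, hb, Fin.sum_univ_two, hb, hb, hcomb] at h
    obtain ⟨a0, c0⟩ := key 0
    obtain ⟨a1, c1⟩ := key 1
    ext i j
    fin_cases i <;> fin_cases j <;> simp [Matrix.mul_apply, Fin.sum_univ_two]
    · linear_combination -a0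
    · linear_combination -a1
    · linear_combination -c0
    · linear_combination -c1
  obtain ⟨h1, h2⟩ := Matrix.det_eq_and_trace_eq_of_mul_eq_mul (det_coord_ne_zero hb) hint
  constructor
  · rw [← LinearMap.det_toMatrix b, RingHom.map_det, h1, Matrix.det_fin_two_of]
    ring
  · rw [LinearMap.trace_eq_matrix_trace A b]
    rw [Matrix.trace_fin_two, Matrix.trace_fin_two_of, RingHom.mapMatrix_apply, Matrix.map_apply,
      Matrix.map_apply, ← map_add, ← Matrix.trace_fin_two] at h2
    rw [h2]
    ring

lemma algebraMap_basisDisc (hb : ∀ i, (b i : E) = x i • (1 : E) + y i • g) :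
    algebraMap A K (basisDisc b) =
      (x 0 * y 1 - x 1 * y 0) ^ 2 * algebraMap A K (t ^ 2 - 4 * m) := by
  have htr (i j : Fin 2) := (hg.trace_det_mulLeft hb (b i * b j)
    (by rw [Subalgebra.coe_mul, hb, hb, hg.mul_eq])).2
  rw [basisDisc, Matrix.det_fin_two]
  simp only [Matrix.of_apply, map_sub, map_mul, htr, map_pow, map_ofNat]
  ring

/-- Another basis is an `A`-combination of `b`, which multiplies the discriminant by the square of a
determinant in `A`. -/
lemma span_basisDisc_eq (hO : ∀ z ∈ O, ∃ u v : K, z = u • (1 : E) + v • g)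
    (b : Module.Basis (Fin 2) A O) :
    Ideal.span {d | ∃ b : Module.Basis (Fin 2) A O, d = basisDisc b} =
      Ideal.span {basisDisc b} := by
  refine le_antisymm (Ideal.span_le.2 ?_) (Ideal.span_mono fun d hd => ⟨b, hd⟩)
  rintro _ ⟨b', rfl⟩
  choose x y hb using fun i => hO _ (b i).2
  have hb' (i : Fin 2) : (b' i : E) =
      (algebraMap A K (b.repr (b' i) 0) * x 0 + algebraMap A K (b.repr (b' i) 1) * x 1) • (1 : E) +
      (algebraMap A K (b.repr (b' i) 0) * y 0 + algebraMap A K (b.repr (b' i) 1) * y 1) • g := by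
    have := congrArg Subtype.val (b.sum_repr (b' i))
    rw [Fin.sum_univ_two] at this
    rw [← this]
    change (b.repr (b' i) 0) • (b 0 : E) + (b.repr (b' i) 1) • (b 1 : E) = _
    rw [← algebraMap_smul_eq (K := K), ← algebraMap_smul_eq (K := K), hb, hb]
    module
  have h1 := hg.algebraMap_basisDisc hb
  have h2 := hg.algebraMap_basisDisc hb'
  refine Ideal.mem_span_singleton.2 ⟨(b.repr (b' 0) 0 * b.repr (b' 1) 1 -
    b.repr (b' 0) 1 * b.repr (b' 1) 0) ^ 2, IsFractionRing.injective A K ?_⟩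
  rw [h2, map_mul, h1]
  simp only [map_pow, map_sub, map_mul]
  ring

/-- Let `D` be the determinant of a basis of `O` in the coordinates `1, g`. Equal discriminants make
`D ^ 2` a unit of `A`, hence `D` too as `A` is integrally closed. Since `1 ∈ O`, the `g`-coordinates
lie in `A`; then the norms force the `1`-coordinates to be integral. So `O` is inside `A + A g`,
with a base change of unit determinant. -/
lemma eq_order_of_span_basisDisc_eq [IsDomain A] [IsIntegrallyClosed A]
    (hδ : t ^ 2 - 4 * m ≠ 0)
    (hO : ∀ z ∈ O, ∃ u v : K, z = u • (1 : E) + v • g)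
    (hd : Ideal.span {d | ∃ b : Module.Basis (Fin 2) A O, d = basisDisc b} =
      Ideal.span {t ^ 2 - 4 * m}) : O = hg.order := by
  have inj := IsFractionRing.injective A K
  obtain ⟨b⟩ : Nonempty (Module.Basis (Fin 2) A O) := by
    -- Without a basis of two elements the generating set is empty and its ideal is `0`, against
    -- `hδ`.
    by_contra hne
    have he : {d | ∃ b : Module.Basis (Fin 2) A O, d = basisDisc b} = ∅ :=
      Set.eq_empty_of_forall_notMem fun d ⟨b, _⟩ => hne ⟨b⟩
    rw [he, Ideal.span_empty, eq_comm, Ideal.span_singleton_eq_bot] at hd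
    exact hδ hd
  rw [hg.span_basisDisc_eq hO b] at hd
  choose x y hb using fun i => hO _ (b i).2
  have hdisc := hg.algebraMap_basisDisc hb
  set D := x 0 * y 1 - x 1 * y 0 with hD
  have hδK : algebraMap A K (t ^ 2 - 4 * m) ≠ 0 := (map_ne_zero_iff _ inj).2 hδ
  -- `D` is a unit of `A`
  obtain ⟨s, hs⟩ := Ideal.mem_span_singleton.1
    (hd ▸ Ideal.mem_span_singleton_self (basisDisc b) : basisDisc b ∈ Ideal.span {t ^ 2 - 4 * m})
  obtain ⟨s', hs'⟩ := Ideal.mem_span_singleton.1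
    (hd ▸ Ideal.mem_span_singleton_self (t ^ 2 - 4 * m) : t ^ 2 - 4 * m ∈ Ideal.span {basisDisc b})
  have hDs : D ^ 2 = algebraMap A K s := by
    rw [hs, map_mul, mul_comm] at hdisc
    exact (mul_right_cancel₀ hδK hdisc).symm
  obtain ⟨D', hD'⟩ : ∃ D', algebraMap A K D' = D :=
    IsIntegrallyClosed.exists_algebraMap_eq_of_isIntegral_pow (n := 2) two_pos
      (hDs ▸ isIntegral_algebraMap)
  have hunit : D' * (D' * s') = 1 := by
    apply inj
    have h1 : s * s' = 1 := by
      refine mul_left_cancel₀ hδ ?_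
      rw [← mul_assoc, ← hs, ← hs', mul_one]
    rw [← mul_assoc, map_mul, map_mul, hD', ← sq, hDs, ← map_mul, h1]
  -- the coordinates of the basis are integral
  have hone : algebraMap A K (b.repr 1 0) * y 0 + algebraMap A K (b.repr 1 1) * y 1 = 0 ∧
      algebraMap A K (b.repr 1 0) * x 0 + algebraMap A K (b.repr 1 1) * x 1 = 1 := by
    have := congrArg Subtype.val (b.sum_repr 1)
    rw [Fin.sum_univ_two] at this
    change (b.repr 1 0) • (b 0 : E) + (b.repr 1 1) • (b 1 : E) = 1 at this
    rw [← algebraMap_smul_eq (K := K), ← algebraMap_smul_eq (K := K), hb, hb] at this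
    have := hg.ext (x' := 1) (y' := 0) (Eq.trans (by module) (this.trans (by module)) :
      (algebraMap A K (b.repr 1 0) * x 0 + algebraMap A K (b.repr 1 1) * x 1) • (1 : E) +
      (algebraMap A K (b.repr 1 0) * y 0 + algebraMap A K (b.repr 1 1) * y 1) • g = _)
    exact ⟨this.2, this.1⟩
  -- Cramer's rule for the expansion of `1` in the basis.
  have hy : ∀ i, ∃ a, algebraMap A K a = y i := by
    refine Fin.forall_fin_two.2 ⟨⟨-(b.repr 1 1 * D'), ?_⟩, ⟨b.repr 1 0 * D', ?_⟩⟩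
    · rw [map_neg, map_mul, hD', hD]
      linear_combination y 0 * hone.2 - x 0 * hone.1
    · rw [map_mul, hD', hD]
      linear_combination y 1 * hone.2 - x 1 * hone.1
  choose y' hy' using hy
  have hx : ∀ i, ∃ a, algebraMap A K a = x i := by
    intro i
    have hdet := (hg.trace_det_mulLeft hb (b i) (hb i)).1
    -- The monic equation for `x i` is the norm formula for `b i`, whose other terms are now in `A`.
    refine IsIntegrallyClosed.isIntegral_iff.1 ⟨X ^ 2 + (C (t * y' i) * X +
      C (m * y' i ^ 2 - LinearMap.det (LinearMap.mulLeft A (b i)))), ?_, ?_⟩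
    · exact monic_X_pow_add (lt_of_le_of_lt degree_linear_le (by norm_num))
    · rw [eval₂_add, eval₂_add, eval₂_pow, eval₂_X, eval₂_mul, eval₂_C, eval₂_C, eval₂_X, map_sub,
        map_mul, map_mul, map_pow, hy', hdet]
      ring
  choose x' hx' using hx
  have hb' (i : Fin 2) : (b i : E) = x' i • (1 : E) + y' i • g := by
    rw [hb, ← hx', ← hy', algebraMap_smul_eq, algebraMap_smul_eq]
  apply le_antisymm
  · intro z hz
    have := congrArg Subtype.val (b.sum_repr ⟨z, hz⟩)
    rw [Fin.sum_univ_two] at this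
    change (b.repr _ 0) • (b 0 : E) + (b.repr _ 1) • (b 1 : E) = z at this
    rw [← this]
    exact add_mem (Subalgebra.smul_mem _ (hg.mem_order.2 ⟨_, _, hb' 0⟩) _)
      (Subalgebra.smul_mem _ (hg.mem_order.2 ⟨_, _, hb' 1⟩) _)
  · have hgO : g ∈ O := by
      have h1 : g = (D' * s') • (x' 0 • (b 1 : E) - x' 1 • (b 0 : E)) := by
        have h2 : x' 0 * y' 1 - x' 1 * y' 0 = D' := by
          apply inj
          rw [map_sub, map_mul, map_mul, hx', hx', hy', hy', hD']
        rw [hb', hb']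
        calc g = (D' * (D' * s')) • g := by rw [hunit, one_smul]
          _ = (D' * s') • ((x' 0 * y' 1 - x' 1 * y' 0) • g) := by rw [h2, smul_smul, mul_comm]
          _ = _ := by module
      rw [h1]
      exact O.smul_mem (sub_mem (O.smul_mem (b 1).2 _) (O.smul_mem (b 0).2 _)) _
    rintro _ ⟨a, c, rfl⟩
    exact add_mem (O.smul_mem (one_mem O) a) (O.smul_mem hgO c)

lemma exists_basis_order : ∃ b : Module.Basis (Fin 2) A hg.order,
    (b 0 : E) = 1 ∧ (b 1 : E) = g := by
  have hgm : g ∈ hg.order := hg.mem_order.2 ⟨0, 1, by module⟩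
  let v : Fin 2 → hg.order := ![1, ⟨g, hgm⟩]
  have hli : LinearIndependent A v := by
    rw [LinearIndependent.pair_iff]
    intro a c hac
    have := congrArg Subtype.val hac
    change a • (1 : E) + c • g = 0 at this
    rw [← algebraMap_smul_eq (K := K) a, ← algebraMap_smul_eq (K := K) c] at this
    obtain ⟨h1, h2⟩ := hg.indep _ _ this
    exact ⟨(map_eq_zero_iff _ (IsFractionRing.injective A K)).1 h1,
      (map_eq_zero_iff _ (IsFractionRing.injective A K)).1 h2⟩
  have hsp : ⊤ ≤ Submodule.span A (Set.range v) := by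
    rintro ⟨z, a, c, rfl⟩ -
    rw [Matrix.range_cons, Matrix.range_cons, Matrix.range_empty, Set.union_empty,
      Set.singleton_union, Submodule.mem_span_pair]
    exact ⟨a, c, rfl⟩
  exact ⟨Module.Basis.mk hli hsp, by simp [v], by simp [v]⟩

lemma span_basisDisc_order :
    Ideal.span {d | ∃ b : Module.Basis (Fin 2) A hg.order, d = basisDisc b} =
      Ideal.span {t ^ 2 - 4 * m} := by
  obtain ⟨b, h0, h1⟩ := hg.exists_basis_order
  rw [hg.span_basisDisc_eq (K := K) _ b]
  · congr 2
    apply IsFractionRing.injective A K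
    rw [hg.algebraMap_basisDisc (b := b) (x := ![1, 0]) (y := ![0, 1])]
    · simp
    · intro i
      fin_cases i
      · simpa using h0
      · simpa using h1
  · rintro _ ⟨a, c, rfl⟩
    exact ⟨algebraMap A K a, algebraMap A K c, by rw [algebraMap_smul_eq, algebraMap_smul_eq]⟩

end IsQuadraticGen

end QuadraticOrder

/-! ### Ordinary modules: `F` has degree two and nonzero discriminant -/

lemma finrank_ne_zero_of_finite (k L : Type*) [Field k] [Field L] [Algebra k L] [Finite L] :
    Module.finrank k L ≠ 0 := by
  have : Module.Finite k L := Module.Finite.of_finite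
  exact Module.finrank_pos.ne'

namespace DrinfeldModuleRankTwo

open OrePoly

variable {Fq L : Type*} [Field Fq] [Fintype Fq] [Field L] [Algebra Fq L] {γ : Fq[X] →ₐ[Fq] L}
variable {Φ : DrinfeldModuleRankTwo Fq L γ}

/-- After cancelling the gcd, `τ ^ k` kills the linear coefficient, so `γ(a) = 0` and a nonzero
`P`-division point `x` satisfies `Φ_a(x) = 0`. As `Φ_a(x) = Φ_b(x) ^ (q ^ k)`, also `Φ_b(x) = 0`,
and Bézout gives `x = 0`. -/
lemma IsOrdinary.eq_zero_of_tau_pow_mul_eq (hΦ : Φ.IsOrdinary) {k : ℕ} (hk : k ≠ 0) {a b : Fq[X]}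
    (h : tau Fq L ^ k * Φ.toAlgHom b = Φ.toAlgHom a) : b = 0 := by
  classical
  have hq := Fintype.one_lt_card (α := Fq)
  by_contra hb
  obtain ⟨d, a', b', hd, hcop, rfl, rfl⟩ : ∃ d a' b', d ≠ 0 ∧ IsCoprime a' b' ∧
      a = a' * d ∧ b = b' * d := by
    have hd : EuclideanDomain.gcd a b ≠ 0 := mt EuclideanDomain.gcd_eq_zero_iff.1 (hb ·.2)
    obtain ⟨a', ha'⟩ := EuclideanDomain.gcd_dvd_left a b
    obtain ⟨b', hb'⟩ := EuclideanDomain.gcd_dvd_right a b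
    refine ⟨_, a', b', hd, ?_, by rw [mul_comm]; exact ha', by rw [mul_comm]; exact hb'⟩
    refine ⟨EuclideanDomain.gcdA a b, EuclideanDomain.gcdB a b, mul_left_cancel₀ hd ?_⟩
    conv_rhs => rw [mul_one, EuclideanDomain.gcd_eq_gcd_ab]
    linear_combination -(EuclideanDomain.gcdA a b) * ha' - EuclideanDomain.gcdB a b * hb'
  have hd' : Φ.toAlgHom d ≠ 0 := (map_ne_zero_iff _ Φ.toAlgHom_injective).2 hd
  rw [map_mul, map_mul, ← mul_assoc] at h
  replace h := mul_right_cancel₀ hd' h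
  have ha : γ a' = 0 := by
    rw [← Φ.coeff_one_lin_toAlgHom, ← h, coeff_lin_mul_one, lin_tau_pow, coeff_X_pow, if_neg,
      zero_mul]
    exact (Nat.one_lt_pow hk hq).ne
  obtain ⟨x, hx, hax⟩ := hΦ
  have h1 : Φ.act (AlgebraicClosure L) a' x = 0 := hax _ ha
  have h2 : Φ.act (AlgebraicClosure L) b' x = 0 := by
    have h3 := h1
    rw [act_apply, ← h, lin_mul, lin_tau_pow, X_pow_comp, map_pow] at h3
    rw [act_apply]
    exact pow_eq_zero_iff (pow_ne_zero _ (by omega)) |>.1 h3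
  obtain ⟨u, v, huv⟩ := hcop
  apply hx
  have h3 : Φ.act (AlgebraicClosure L) (u * a' + v * b') x = 0 := by
    rw [map_add, map_mul, map_mul, LinearMap.add_apply, Module.End.mul_apply, Module.End.mul_apply,
      h1, h2, map_zero, map_zero, add_zero]
  rwa [huv, map_one, Module.End.one_apply] at h3

variable (Φ) in
/-- The inclusion of `End_L Φ` in `L{τ}`. -/
noncomputable def endVal : Φ.End →+* OrePoly Fq L :=
  (Subalgebra.centralizer Fq (Set.range Φ.toAlgHom)).val.toRingHom

lemma endVal_injective : Function.Injective Φ.endVal := Subtype.val_injective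

lemma endVal_smul (a : Fq[X]) (u : Φ.End) : Φ.endVal (a • u) = Φ.toAlgHom a * Φ.endVal u := by
  rw [Algebra.smul_def, map_mul]
  rfl

lemma endVal_smul_one (a : Fq[X]) : Φ.endVal (a • (1 : Φ.End)) = Φ.toAlgHom a := by
  rw [endVal_smul, map_one, mul_one]

lemma endVal_commute (a : Fq[X]) (u : Φ.End) :
    Φ.toAlgHom a * Φ.endVal u = Φ.endVal u * Φ.toAlgHom a :=
  u.2 _ ⟨a, rfl⟩

lemma exists_endVal_eq {u : OrePoly Fq L} (h : ∀ a, Φ.toAlgHom a * u = u * Φ.toAlgHom a) :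
    ∃ v, Φ.endVal v = u :=
  ⟨⟨u, by rintro _ ⟨a, rfl⟩; exact h a⟩, rfl⟩

instance : NoZeroDivisors Φ.End := endVal_injective.noZeroDivisors Φ.endVal (map_zero _) (map_mul _)

instance : Nontrivial Φ.End := Φ.endVal.domain_nontrivial

instance : IsDomain Φ.End := NoZeroDivisors.to_isDomain _

instance : Module.IsTorsionFree Fq[X] Φ.End := by
  refine .of_smul_eq_zero fun a u h => ?_
  have := congrArg Φ.endVal h
  rw [endVal_smul, map_zero, mul_eq_zero] at this
  refine this.imp (fun h => ?_) fun h => endVal_injective (h.trans (map_zero _).symm)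
  exact (map_eq_zero_iff _ Φ.toAlgHom_injective).1 h

lemma toEndK_injective : Function.Injective Φ.toEndK :=
  Algebra.TensorProduct.includeRight_injective (IsFractionRing.injective Fq[X] _)

section Frobenius

variable [Finite L]

lemma endVal_frob : Φ.endVal Φ.frob = tau Fq L ^ Module.finrank Fq L := rfl

lemma IsOrdinary.frob_indep (hΦ : Φ.IsOrdinary) {a b : Fq[X]}
    (h : a • (1 : Φ.End) + b • Φ.frob = 0) : a = 0 ∧ b = 0 := by
  have hb : b = 0 := by
    refine hΦ.eq_zero_of_tau_pow_mul_eq (k := Module.finrank Fq L) (a := -a)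
      (finrank_ne_zero_of_finite Fq L) ?_
    have := congrArg Φ.endVal h
    rw [map_add, endVal_smul_one, endVal_smul, map_zero, endVal_commute, endVal_frob] at this
    rw [map_neg]
    exact (neg_eq_of_add_eq_zero_right this).symm
  refine ⟨?_, hb⟩
  rw [hb, zero_smul, add_zero] at h
  exact (smul_eq_zero.1 h).resolve_right one_ne_zero

lemma IsOrdinary.natDegree_minpoly (hΦ : Φ.IsOrdinary) :
    IsIntegral Fq[X] Φ.frob ∧ (minpoly Fq[X] Φ.frob).natDegree = 2 := by
  obtain ⟨c, N, h⟩ := exists_frobenius_quadratic Φ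
  have hq : Φ.frob ^ 2 - c • Φ.frob + N • (1 : Φ.End) = 0 := by
    apply endVal_injective
    rw [map_add, map_sub, map_pow, endVal_smul, endVal_commute, endVal_smul_one, endVal_frob, h,
      map_zero]
  have hdeg : (-C c * X + C N : Fq[X][X]).degree < 2 := by
    rw [← C_neg]; exact lt_of_le_of_lt degree_linear_le (by norm_num)
  have hmonic : (X ^ 2 + (-C c * X + C N) : Fq[X][X]).Monic := monic_X_pow_add hdeg
  have hroot : aeval Φ.frob (X ^ 2 + (-C c * X + C N) : Fq[X][X]) = 0 := by
    rw [← hq]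
    simp only [map_add, map_pow, aeval_X, map_mul, map_neg, aeval_C, Algebra.smul_def, mul_one]
    noncomm_ring
  have hint : IsIntegral Fq[X] Φ.frob := ⟨_, hmonic, hroot⟩
  refine ⟨hint, le_antisymm ?_ ?_⟩
  · refine natDegree_le_of_degree_le ((minpoly.min Fq[X] Φ.frob hmonic hroot).trans ?_)
    refine (degree_add_le _ _).trans (max_le ?_ hdeg.le)
    rw [degree_X_pow]
  · by_contra hlt
    have h1 : (minpoly Fq[X] Φ.frob).natDegree = 1 := by
      have := minpoly.natDegree_pos hint
      omega
    have h2 := minpoly.aeval Fq[X] Φ.frob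
    have h3 := minpoly.monic hint
    rw [aeval_eq_sum_range, h1, Finset.sum_range_succ, Finset.sum_range_one, pow_zero,
      pow_one] at h2
    have h4 := (hΦ.frob_indep h2).2
    rw [Monic, leadingCoeff, h1, h4] at h3
    exact zero_ne_one h3

lemma IsOrdinary.charpoly_eq (hΦ : Φ.IsOrdinary) : Φ.charpoly = minpoly Fq[X] Φ.frob := by
  rw [charpoly, hΦ.natDegree_minpoly.2, Nat.div_self two_pos, pow_one]

lemma IsOrdinary.coeff_charpoly_two (hΦ : Φ.IsOrdinary) : Φ.charpoly.coeff 2 = 1 := by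
  have h := minpoly.monic hΦ.natDegree_minpoly.1
  rwa [Monic, leadingCoeff, hΦ.natDegree_minpoly.2, ← hΦ.charpoly_eq] at h

lemma IsOrdinary.frob_mul_frob (hΦ : Φ.IsOrdinary) :
    Φ.frob * Φ.frob = Φ.trace • Φ.frob - Φ.charpoly.coeff 0 • (1 : Φ.End) := by
  have h := minpoly.aeval Fq[X] Φ.frob
  rw [aeval_eq_sum_range, hΦ.natDegree_minpoly.2, ← hΦ.charpoly_eq, Finset.sum_range_succ,
    Finset.sum_range_succ, Finset.sum_range_one, hΦ.coeff_charpoly_two, one_smul, pow_zero, pow_one,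
    sq] at h
  rw [trace, neg_smul, eq_comm, ← sub_eq_zero, ← neg_eq_zero, ← h]
  abel

lemma IsOrdinary.eval_one_charpoly (hΦ : Φ.IsOrdinary) :
    Φ.charpoly.eval 1 = 1 - Φ.trace + Φ.charpoly.coeff 0 := by
  have h : Φ.charpoly.natDegree = 2 := by rw [hΦ.charpoly_eq, hΦ.natDegree_minpoly.2]
  rw [eval_eq_sum_range, h, Finset.sum_range_succ, Finset.sum_range_succ, Finset.sum_range_one,
    hΦ.coeff_charpoly_two, trace]
  simp only [one_pow, mul_one]
  ring

/-- `(2F - c)² = Δ` in a domain, so `Δ = 0` would give `c = 0` and `2 = 0` by independence of `1,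
F`. Then `F² = -N`, putting `τ ^ (2n)` in the image of `A`, which ordinariness forbids. -/
lemma IsOrdinary.discriminant_ne_zero (hΦ : Φ.IsOrdinary) : Φ.discriminant ≠ 0 := by
  intro h
  have h1 : ((-Φ.trace) • (1 : Φ.End) + (2 : Fq[X]) • Φ.frob) *
      ((-Φ.trace) • (1 : Φ.End) + (2 : Fq[X]) • Φ.frob) = Φ.discriminant • (1 : Φ.End) := by
    rw [add_mul, mul_add, mul_add]
    simp only [smul_mul_smul_comm, one_mul, mul_one, hΦ.frob_mul_frob, discriminant]
    module
  rw [h, zero_smul, mul_self_eq_zero] at h1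
  obtain ⟨h2, h3⟩ := hΦ.frob_indep h1
  have h4 := congrArg Φ.endVal hΦ.frob_mul_frob
  rw [neg_eq_zero.1 h2, zero_smul, zero_sub, map_mul, map_neg, endVal_smul_one, endVal_frob,
    ← pow_add, ← map_neg, ← mul_one (_ ^ _), ← map_one Φ.toAlgHom] at h4
  exact one_ne_zero (hΦ.eq_zero_of_tau_pow_mul_eq
    (by have := finrank_ne_zero_of_finite Fq L; omega) h4)

end Frobenius

end DrinfeldModuleRankTwo

/-! ### Torsion points and divisibility of `F - 1` -/

namespace Polynomial

lemma card_roots_of_dvd_X_pow_card_sub_X {L : Type*} [Field L] [Finite L] {p : L[X]}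
    (h : p ∣ X ^ Nat.card L - X) : Nat.card {x : L // p.eval x = 0} = p.natDegree := by
  classical
  have := Fintype.ofFinite L
  rw [Nat.card_eq_fintype_card] at h
  have hne : (X ^ Fintype.card L - X : L[X]) ≠ 0 :=
    FiniteField.X_pow_card_sub_X_ne_zero _ Fintype.one_lt_card
  have hp : p ≠ 0 := ne_zero_of_dvd_ne_zero hne h
  have hs : (X ^ Fintype.card L - X : L[X]).Splits := by
    rw [splits_iff_card_roots, FiniteField.roots_X_pow_card_sub_X,
      FiniteField.X_pow_card_sub_X_natDegree_eq _ Fintype.one_lt_card]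
    rfl
  have hnd : p.roots.Nodup := by
    refine Multiset.nodup_of_le (roots.le_of_dvd hne h) ?_
    rw [FiniteField.roots_X_pow_card_sub_X]
    exact Finset.univ.nodup
  rw [← splits_iff_card_roots.1 (hs.of_dvd hne h), ← Multiset.toFinset_card_of_nodup hnd,
    ← Nat.card_eq_finsetCard]
  refine Nat.card_congr (Equiv.subtypeEquivRight fun x => ?_)
  rw [Multiset.mem_toFinset, mem_roots hp, IsRoot.def]

end Polynomial

namespace DrinfeldModuleRankTwo

open OrePoly

variable {Fq L : Type*} [Field Fq] [Fintype Fq] [Field L] [Algebra Fq L] {γ : Fq[X] →ₐ[Fq] L}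
variable {Φ : DrinfeldModuleRankTwo Fq L γ}

lemma card_torsionBy (d : Fq[X]) : Nat.card (Submodule.torsionBy Fq[X] Φ.Points d) =
    Nat.card {x : L // (lin (Φ.toAlgHom d)).eval x = 0} := by
  refine Nat.card_congr (Φ.pointsEquiv.toEquiv.subtypeEquiv fun x => ?_)
  rw [Submodule.mem_torsionBy_iff, ← map_eq_zero_iff _ Φ.pointsEquiv.injective, pointsEquiv_smul]
  rfl

variable [Finite L]

lemma lin_tau_pow_finrank_sub_one :
    lin (tau Fq L ^ Module.finrank Fq L - 1) = X ^ Nat.card L - X := by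
  rw [map_sub, lin_tau_pow, lin_one, ← Nat.card_eq_fintype_card,
    ← Module.natCard_eq_pow_finrank (K := Fq) (V := L)]

lemma torsionContained_of_frob_sub_one_eq {r : Fq[X]} (hr : r ≠ 0) {u : Φ.End}
    (h : Φ.frob - 1 = r • u) : Φ.TorsionContained (Ideal.span {r}) := by
  have hcard : ∀ d, d ∣ r → Nat.card (Submodule.torsionBy Fq[X] Φ.Points d) =
      Fintype.card Fq ^ (2 * d.natDegree) := by
    rintro d ⟨e, rfl⟩
    rw [card_torsionBy, card_roots_of_dvd_X_pow_card_sub_X,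
      natDegree_lin_toAlgHom _ (left_ne_zero_of_mul hr)]
    have h1 := congrArg Φ.endVal h
    rw [endVal_smul, endVal_commute, mul_comm d e, map_mul, ← mul_assoc, map_sub, map_one,
      endVal_frob] at h1
    rw [← lin_tau_pow_finrank_sub_one (Fq := Fq), h1, lin_mul]
    -- The outer polynomial has no constant term, so composing it with that of `Φ_d` gives a
    -- multiple of the latter: right factors become ordinary divisors.
    obtain ⟨w, hw⟩ := X_dvd_iff.2 (coeff_lin_zero (Φ.endVal u * Φ.toAlgHom e))
    rw [hw, mul_comp, X_comp]
    exact dvd_mul_right _ _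
  obtain ⟨m₁, m₂, h₁, h₂, hm⟩ := exists_independent_of_card_torsionBy hr hcard
  exact exists_injective_of_independent h₁ h₂ hm

lemma frob_sub_one_eq_of_torsionContained {r : Fq[X]} (hr : r ≠ 0)
    (h : Φ.TorsionContained (Ideal.span {r})) : ∃ u : Φ.End, Φ.frob - 1 = r • u := by
  obtain ⟨f, hf⟩ := h
  have hr' : Φ.toAlgHom r ≠ 0 := (map_ne_zero_iff _ Φ.toAlgHom_injective).2 hr
  obtain ⟨u, s, hus, hs⟩ := exists_eq_mul_add hr' (tau Fq L ^ Module.finrank Fq L - 1)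
  have hker (z) : (lin (Φ.toAlgHom r)).eval (Φ.pointsEquiv (f z)) = 0 := by
    rw [← pointsEquiv_smul, ← map_smul]
    have : r • z = 0 := by
      have h0 (w : Fq[X] ⧸ Ideal.span {r}) : r • w = 0 := by
        obtain ⟨w, rfl⟩ := Submodule.Quotient.mk_surjective _ w
        rw [← Submodule.Quotient.mk_smul, Submodule.Quotient.mk_eq_zero]
        exact Ideal.mem_span_singleton.2 (dvd_mul_right r w)
      exact Prod.ext (h0 _) (h0 _)
    rw [this, map_zero, map_zero]
  -- Both `τ ^ n - 1` and `Φ_r` vanish on the image of `f`, so `s` does too; the image has `q ^ (2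
  -- deg r)` points, more than the degree of `s`.
  have hs0 : lin s = 0 := by
    by_contra hne
    have := finite_quotient_span hr
    have := Fintype.ofFinite ((Fq[X] ⧸ Ideal.span {r}) × (Fq[X] ⧸ Ideal.span {r}))
    refine hne (eq_zero_of_natDegree_lt_card_of_eval_eq_zero (lin s)
      (f := fun z => Φ.pointsEquiv (f z)) (Φ.pointsEquiv.injective.comp hf) (fun z => ?_) ?_)
    · have h1 := congrArg (fun p => (lin p).eval (Φ.pointsEquiv (f z))) hus
      have := Fintype.ofFinite L
      simp only [lin_tau_pow_finrank_sub_one, map_add, lin_mul, eval_add, eval_comp, hker,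
        eval_sub, eval_pow, eval_X, Nat.card_eq_fintype_card, FiniteField.pow_card, sub_self] at h1
      rw [← coeff_zero_eq_eval_zero, coeff_lin_zero, zero_add] at h1
      exact h1.symm
    · refine (natDegree_lt_natDegree hne hs).trans_eq ?_
      rw [natDegree_lin_toAlgHom _ hr, ← Nat.card_eq_fintype_card (α := _ × _), Nat.card_prod,
        card_quotient_span hr, ← pow_add, two_mul]
  rw [lin_eq_zero.1 hs0, add_zero] at hus
  -- `u` commutes with `Φ_a` because `u Φ_r = F - 1` does and `Φ_r` can be cancelled on the right.
  obtain ⟨v, hv⟩ : ∃ v, Φ.endVal v = u := exists_endVal_eq fun a => by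
    refine mul_right_cancel₀ hr' ?_
    have h1 : Φ.endVal (Φ.frob - 1) = u * Φ.toAlgHom r := by
      rw [map_sub, map_one, endVal_frob, hus]
    rw [mul_assoc, ← h1, endVal_commute, h1, mul_assoc, mul_assoc, ← map_mul, ← map_mul, mul_comm]
  refine ⟨v, endVal_injective ?_⟩
  rw [endVal_smul, endVal_commute, hv, ← hus, map_sub, map_one, endVal_frob]

lemma torsionContained_span_iff {r : Fq[X]} (hr : r ≠ 0) :
    Φ.TorsionContained (Ideal.span {r}) ↔ ∃ u : Φ.End, Φ.frob - 1 = r • u :=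
  ⟨frob_sub_one_eq_of_torsionContained hr, fun ⟨_, h⟩ => torsionContained_of_frob_sub_one_eq hr h⟩

/-! ### The order generated by `(F - 1) / r` -/

lemma IsOrdinary.frob_indep_endK (hΦ : Φ.IsOrdinary) (x y : FractionRing Fq[X])
    (h : x • (1 : Φ.EndK) + y • Φ.toEndK Φ.frob = 0) : x = 0 ∧ y = 0 := by
  have h1 : LinearIndependent Fq[X] ![(1 : Φ.EndK), Φ.toEndK Φ.frob] := by
    rw [LinearIndependent.pair_iff]
    intro a b hab
    refine hΦ.frob_indep (toEndK_injective ?_)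
    rw [map_add, map_smul, map_smul, map_one, map_zero, hab]
  exact LinearIndependent.pair_iff.1
    ((LinearIndependent.iff_fractionRing Fq[X] (FractionRing Fq[X])).1 h1) x y h

variable (Φ) in
/-- The element `(F - 1) / r` of `K(F)`. -/
noncomputable def frobSubOneDiv (r : Fq[X]) : Φ.EndK :=
  (algebraMap Fq[X] (FractionRing Fq[X]) r)⁻¹ • (Φ.toEndK Φ.frob - 1)

lemma smul_frobSubOneDiv {r : Fq[X]} (hr : r ≠ 0) :
    r • Φ.frobSubOneDiv r = Φ.toEndK (Φ.frob - 1) := by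
  have hr' : algebraMap Fq[X] (FractionRing Fq[X]) r ≠ 0 :=
    (map_ne_zero_iff _ (IsFractionRing.injective _ _)).2 hr
  rw [frobSubOneDiv, ← algebraMap_smul_eq (K := FractionRing Fq[X]), smul_smul,
    mul_inv_cancel₀ hr', one_smul, map_sub, map_one]

lemma toEndK_frob {r : Fq[X]} (hr : r ≠ 0) : Φ.toEndK Φ.frob =
    (1 : FractionRing Fq[X]) • (1 : Φ.EndK) +
      algebraMap Fq[X] (FractionRing Fq[X]) r • Φ.frobSubOneDiv r := by
  rw [algebraMap_smul_eq, smul_frobSubOneDiv hr, map_sub, map_one, one_smul, add_sub_cancel]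

/-- Substituting `X = 1 + Y` in `P_Φ` gives `(F - 1)² = (c - 2)(F - 1) - P_Φ(1)`; divide by `r ^ 2`.
-/
lemma IsOrdinary.isQuadraticGen (hΦ : Φ.IsOrdinary) {r t m : Fq[X]} (hr : r ≠ 0)
    (ht : Φ.trace - 2 = r * t) (hm : Φ.charpoly.eval 1 = r ^ 2 * m) :
    IsQuadraticGen (FractionRing Fq[X]) (Φ.frobSubOneDiv r) t m where
  mul_self := by
    have hr' : algebraMap Fq[X] (FractionRing Fq[X]) (r ^ 2) ≠ 0 :=
      (map_ne_zero_iff _ (IsFractionRing.injective _ _)).2 (pow_ne_zero 2 hr)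
    refine (smul_right_injective _ hr') ?_
    simp only [algebraMap_smul_eq]
    have h1 : (Φ.frob - 1) * (Φ.frob - 1) =
        (r * t) • (Φ.frob - 1) - (r ^ 2 * m) • (1 : Φ.End) := by
      rw [← ht, ← hm, hΦ.eval_one_charpoly, sub_mul, mul_sub, hΦ.frob_mul_frob, mul_one, one_mul]
      module
    have h2 := congrArg Φ.toEndK h1
    rw [map_mul, map_sub _ (_ • _), map_smul, map_smul, map_one, ← smul_frobSubOneDiv hr,
      smul_mul_smul_comm, ← sq] at h2
    rw [h2]
    module
  indep x y h := by
    have hr' : algebraMap Fq[X] (FractionRing Fq[X]) r ≠ 0 :=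
      (map_ne_zero_iff _ (IsFractionRing.injective _ _)).2 hr
    set r' := algebraMap Fq[X] (FractionRing Fq[X]) r
    rw [frobSubOneDiv, smul_one_add_smul_smul_sub_one] at h
    obtain ⟨h2, h3⟩ := hΦ.frob_indep_endK _ _ h
    rw [h3, sub_zero] at h2
    exact ⟨h2, (mul_eq_zero.1 h3).resolve_right (inv_ne_zero hr')⟩

lemma mem_frobField_iff {r t m : Fq[X]} (hr : r ≠ 0)
    (hg : IsQuadraticGen (FractionRing Fq[X]) (Φ.frobSubOneDiv r) t m) {z : Φ.EndK} :
    z ∈ Φ.frobField ↔ ∃ u v : FractionRing Fq[X], z = u • (1 : Φ.EndK) + v • Φ.frobSubOneDiv r :=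
  hg.mem_adjoin_singleton_iff (toEndK_frob hr)
    ((map_ne_zero_iff _ (IsFractionRing.injective _ _)).2 hr)

lemma isOrder_order {r t m : Fq[X]} (hr : r ≠ 0)
    (hg : IsQuadraticGen (FractionRing Fq[X]) (Φ.frobSubOneDiv r) t m) : Φ.IsOrder hg.order := by
  constructor
  · obtain ⟨b, -⟩ := hg.exists_basis_order
    have : Module.Finite Fq[X] hg.order := Module.Finite.of_basis b
    exact Module.Finite.iff_fg.1 this
  · apply le_antisymm
    · refine Submodule.span_le.2 ?_
      rintro _ ⟨a, b, rfl⟩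
      refine (mem_frobField_iff hr hg).2 ⟨algebraMap _ _ a, algebraMap _ _ b, ?_⟩
      rw [algebraMap_smul_eq, algebraMap_smul_eq]
    · intro z hz
      obtain ⟨u, v, rfl⟩ := (mem_frobField_iff hr hg).1 hz
      exact add_mem (Submodule.smul_mem _ _ (Submodule.subset_span (one_mem hg.order)))
        (Submodule.smul_mem _ _ (Submodule.subset_span ⟨0, 1, by module⟩))

lemma order_le_endImage_iff {r t m : Fq[X]} (hr : r ≠ 0)
    (hg : IsQuadraticGen (FractionRing Fq[X]) (Φ.frobSubOneDiv r) t m) :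
    hg.order ≤ Φ.endImage ↔ ∃ u : Φ.End, Φ.frob - 1 = r • u := by
  have hmem : Φ.frobSubOneDiv r ∈ Φ.endImage ↔ ∃ u : Φ.End, Φ.frob - 1 = r • u := by
    have hr' : algebraMap Fq[X] (FractionRing Fq[X]) r ≠ 0 :=
      (map_ne_zero_iff _ (IsFractionRing.injective _ _)).2 hr
    refine exists_congr fun u => ⟨fun h => toEndK_injective ?_, fun h => ?_⟩
    · rw [← smul_frobSubOneDiv hr, map_smul]
      exact congrArg (r • ·) h.symm
    · refine smul_right_injective _ hr' ?_
      simp only [algebraMap_smul_eq]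
      rw [smul_frobSubOneDiv hr, h, map_smul]
      rfl
  rw [← hmem]
  constructor
  · exact fun h => h ⟨0, 1, by module⟩
  · rintro h _ ⟨a, b, rfl⟩
    exact add_mem (Subalgebra.smul_mem _ (one_mem _) _) (Subalgebra.smul_mem _ h _)

end DrinfeldModuleRankTwo

theorem proposition2p3 {Fq L : Type*} [Field Fq] [Fintype Fq] [Field L] [Finite L] [Algebra Fq L]
    (γ : Fq[X] →ₐ[Fq] L) (Φ : DrinfeldModuleRankTwo Fq L γ) (hΦ : Φ.IsOrdinary)
    (ρ : Ideal Fq[X]) (hρ : ρ ≠ RingHom.ker γ)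
    (h₁ : ρ ^ 2 ∣ Ideal.span {Φ.charpoly.eval 1}) (h₂ : ρ ∣ Ideal.span {Φ.trace - 2}) :
    (∃! O : Subalgebra Fq[X] Φ.EndK,
      Φ.IsOrder O ∧ Φ.orderDisc O * ρ ^ 2 = Ideal.span {Φ.discriminant}) ∧
    ∀ O : Subalgebra Fq[X] Φ.EndK,
      Φ.IsOrder O → Φ.orderDisc O * ρ ^ 2 = Ideal.span {Φ.discriminant} →
        (Φ.TorsionContained ρ ↔ O ≤ Φ.endImage) := by
  obtain ⟨r, rfl⟩ : ∃ r, ρ = Ideal.span {r} := ⟨_, (Ideal.span_singleton_generator ρ).symm⟩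
  rw [Ideal.span_singleton_pow, Ideal.dvd_iff_le, Ideal.span_singleton_le_span_singleton] at h₁
  rw [Ideal.dvd_iff_le, Ideal.span_singleton_le_span_singleton] at h₂
  obtain ⟨m, hm⟩ := h₁
  obtain ⟨t, ht⟩ := h₂
  -- From `c² - 4N = (c - 2)² - 4 P_Φ(1)`.
  have hΔ : Φ.discriminant = (t ^ 2 - 4 * m) * r ^ 2 := by
    have h := hΦ.eval_one_charpoly
    rw [DrinfeldModuleRankTwo.discriminant]
    linear_combination (Φ.trace - 2 + r * t) * ht - 4 * hm + 4 * h
  have hΔ0 := hΦ.discriminant_ne_zero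
  have hr : r ≠ 0 := by
    rintro rfl
    exact hΔ0 (by rw [hΔ]; ring)
  have hδ : t ^ 2 - 4 * m ≠ 0 := by
    intro h
    exact hΔ0 (by rw [hΔ, h, zero_mul])
  have hg := hΦ.isQuadraticGen hr ht hm
  -- The nonzero ideal `(r ^ 2)` cancels.
  have hdisc (O : Subalgebra Fq[X] Φ.EndK) :
      Φ.orderDisc O * Ideal.span {r} ^ 2 = Ideal.span {Φ.discriminant} ↔
        Ideal.span {d | ∃ b : Module.Basis (Fin 2) Fq[X] O, d = basisDisc b} =
          Ideal.span {t ^ 2 - 4 * m} := by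
    have h0 : (Ideal.span {r ^ 2} : Ideal Fq[X]) ≠ 0 := by
      rw [Ne, Ideal.zero_eq_bot, Ideal.span_singleton_eq_bot]
      exact pow_ne_zero 2 hr
    rw [hΔ, ← Ideal.span_singleton_mul_span_singleton, Ideal.span_singleton_pow]
    exact mul_left_inj' h0
  have huniq (O : Subalgebra Fq[X] Φ.EndK) (hO : Φ.IsOrder O)
      (hd : Φ.orderDisc O * Ideal.span {r} ^ 2 = Ideal.span {Φ.discriminant}) : O = hg.order :=
    hg.eq_order_of_span_basisDisc_eq hδ (fun z hz =>
      (DrinfeldModuleRankTwo.mem_frobField_iff hr hg).1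
        (hO.2.le (Submodule.subset_span hz))) ((hdisc O).1 hd)
  refine ⟨⟨hg.order, ⟨DrinfeldModuleRankTwo.isOrder_order hr hg,
    (hdisc _).2 hg.span_basisDisc_order⟩, fun O hO => huniq O hO.1 hO.2⟩, fun O hO hd => ?_⟩
  rw [huniq O hO hd, DrinfeldModuleRankTwo.torsionContained_span_iff hr,
    DrinfeldModuleRankTwo.order_le_endImage_iff hr hg]
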